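/- **Setting.** Let $\mathcal M$ be a finite-dimensional von Neumann algebra, realized as a unital $*$-subalgebra of $M_n(\mathbb C)$ with the trace $\mathrm{Tr}$ of $M_n(\mathbb C)$, and let $\mathcal N\subseteq\mathcal M$ be a von Neumann subalgebra. For $X\in\mathcal M$ let $X_{\mathcal N}$ be the orthogonal projection of $X$ onto $\mathcal N$ with respect to $\langle X,Y\rangle=\mathrm{Tr}(X^*Y)$. For a positive semidefinite matrix $A$, $A^{-1}$ denotes the generalized inverse (inverse on the range of $A$, zero on the kernel), and $A^{-1/2}=(A^{-1})^{1/2}$. $\|\cdot\|_1$ is the trace norm and $\|\cdot\|$ the operator norm. For density matrices $\rho,\sigma\in\mathcal M$ put $$\mathscr R_\rho(X)=\rho^{1/2}\rho_{\mathcal N}^{-1/2}X\rho_{\mathcal N}^{-1/2}\rho^{1/2},\qquad \Delta_{\sigma,\rho}(X)=\sigma X\rho^{-1},\qquad S_f(\rho\|\sigma)=\langle\rho^{1/2},f(\Delta_{\sigma,\rho})\rho^{1/2}\rangle\in(-\infty,+\infty],$$ for $f:(0,\infty)\to\mathbb R$ operator monotone decreasing, with $f(0):=\lim_{x\downarrow0}f(x)\in(-\infty,+\infty]$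 and $\infty\cdot 0=0$. Such an $f$ is *regular* if in the canonical representation $$-f(x)=ax+b+\int_0^\infty\Big(\frac t{t^2+1}-\frac1{t+x}\Big)d\mu_f(t),\qquad a\ge0,\ b\in\mathbb R,\ \int_0^\infty\frac{d\mu_f(t)}{t^2+1}<\infty,$$ the measure $\mu_f$ is absolutely continuous with respect to Lebesgue measure and for all $S,T>0$ there is a finite constant $C^f_{S,T}$ with $dt\le C^f_{S,T}\,d\mu_f(t)$ on $[1/S,T]$. Let $C^f_{T,1/2}$ be the least constant (the infimum of the constants) with $dt\le C^f_{T,1/2}\,d\mu_f(t)$ on $[T^{-1},T]$. **Statement.** Let $f$ be a regular operator monotone decreasing function, and suppose that $C^f_{T,1/2}\le C\,T^{2c}$ for all $T>0$, with constants $c,C>0$. Let $\rho,\sigma\in\mathcal M$ be density matrices with $\ker\rho\subseteq\ker\sigma$ (automatic if $\rho$ is invertible). Then $S_f(\rho_{\mathcal N}\|\sigma_{\mathcal N})\le S_f(\rho\|\sigma)$, and: 1. If $S_f(\rho\|\sigma)<\infty$, then $$\|\mathscr R_\rho(\sigma_{\mathcal N})-\sigma\|_1\le K'\,\big(S_f(\rho\|\sigma)-S_f(\rho_{\mathcal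 N}\|\sigma_{\mathcal N})\big)^{\frac1{4(1+c)}},$$ where $K'$ depends only on the smallest non-zero eigenvalue of $\rho$, $C$ and $c$. 2. If $\sigma_{\mathcal N}$ is invertible and $S_f(\rho\|\sigma)<\infty$, then $$\max\{\|\mathscr R_\rho(\sigma_{\mathcal N})-\sigma\|_1,\ \|\mathscr R_\sigma(\rho_{\mathcal N})-\rho\|_1\}\le K\,\big(S_f(\rho\|\sigma)-S_f(\rho_{\mathcal N}\|\sigma_{\mathcal N})\big)^{\frac1{4(1+c)}},$$ where $K$ depends only on the smallest non-zero eigenvalue of $\rho$, $\|\sigma_{\mathcal N}^{-1}\|$, $C$ and $c$. 3. Consequently, if $\sigma_{\mathcal N}$ is invertible, then $S_f(\rho\|\sigma)=S_f(\rho_{\mathcal N}\|\sigma_{\mathcal N})$ if and only if both $\sigma=\mathscr R_\rho(\sigma_{\mathcal N})$ and $\rho=\mathscr R_\sigma(\rho_{\mathcal N})$; moreover, either one of these two equations already implies $S_f(\rho\|\sigma)=S_f(\rho_{\mathcal N}\|\sigma_{\mathcal N})$. -/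

import Mathlib

open MeasureTheory
open scoped ENNReal ComplexOrder

noncomputable section

namespace QuasiEntropy

/-! ### Operator monotone functions and their canonical integral representation -/

/-- `f` is operator monotone decreasing on `(0,∞)`: for positive definite matrices `A ≤ B` of any
size, `f(A) - f(B)` is positive semidefinite. Only the values of `f` on `(0,∞)` matter. -/
def OperatorMonotoneDecreasing (f : ℝ → ℝ) : Prop :=
  ∀ (m : ℕ) (A B : Matrix (Fin m) (Fin m) ℂ), A.PosDef → B.PosDef →
    (B - A).PosSemidef → (cfc f A - cfc f B).PosSemidef

/-- `a`, `b`, `μ` are the data of the canonical integral representation of the Pick function `g`: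
`g(x) = a x + b + ∫_0^∞ (t/(t²+1) - 1/(t+x)) dμ(t)` for `x > 0`, where `a ≥ 0` and `μ` is a positive
measure on `(0,∞)` with `∫ 1/(t²+1) dμ < ∞`. (The data are determined by `g` on `(0,∞)`.) -/
structure CanonicalRepresentation (g : ℝ → ℝ) (a b : ℝ) (μ : Measure ℝ) : Prop where
  nonneg : 0 ≤ a
  measure_Iic_zero : μ (Set.Iic 0) = 0
  integrable : Integrable (fun t : ℝ => 1 / (t ^ 2 + 1)) μ
  eq_integral : ∀ x : ℝ, 0 < x → g x = a * x + b + ∫ t, (t / (t ^ 2 + 1) - 1 / (t + x)) ∂μ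

/-- `dt ≤ K dμ(t)` on the interval `[S⁻¹, T]`. -/
def LebesgueLE (μ : Measure ℝ) (K : ℝ≥0∞) (S T : ℝ) : Prop :=
  (volume : Measure ℝ).restrict (Set.Icc S⁻¹ T) ≤ K • μ.restrict (Set.Icc S⁻¹ T)

/-- The regularity condition on the measure of the canonical representation: it is absolutely
continuous, and for all `S, T > 0` there is a finite constant `K` with `dt ≤ K dμ` on `[S⁻¹, T]`. -/
def RegularMeasure (μ : Measure ℝ) : Prop :=
  μ ≪ volume ∧ ∀ S T : ℝ, 0 < S → 0 < T → ∃ K : ℝ≥0∞, K ≠ ∞ ∧ LebesgueLE μ K S T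

/-- The least constant `K` such that `dt ≤ K dμ` on `[T⁻¹, T]`. -/
def leastConst (μ : Measure ℝ) (T : ℝ) : ℝ≥0∞ :=
  sInf {K : ℝ≥0∞ | LebesgueLE μ K T T}

/-! ### The Hilbert–Schmidt space -/

variable {n : ℕ}

/-- The Hilbert space of `n × n` matrices with the Hilbert–Schmidt inner product
`⟨X, Y⟩ = Tr(X* Y) = ∑ conj (X i j) * Y i j`. -/
abbrev HS (n : ℕ) : Type := EuclideanSpace ℂ (Fin n × Fin n)

/-- The identification of matrices with vectors of the Hilbert–Schmidt space. -/
def toHS (n : ℕ) : Matrix (Fin n) (Fin n) ℂ ≃ₗ[ℂ] HS n where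
  toFun X := WithLp.toLp 2 fun p => X p.1 p.2
  invFun v := Matrix.of fun i j => v (i, j)
  map_add' _ _ := rfl
  map_smul' _ _ := rfl
  left_inv _ := rfl
  right_inv _ := rfl

/-- The conditional expectation onto `N`: the orthogonal projection onto the subalgebra `N` with
respect to the Hilbert–Schmidt inner product. -/
def hsCondExp (N : StarSubalgebra ℂ (Matrix (Fin n) (Fin n) ℂ)) (X : Matrix (Fin n) (Fin n) ℂ) :
    Matrix (Fin n) (Fin n) ℂ :=
  (toHS n).symm
    ((N.toSubalgebra.toSubmodule.map (toHS n).toLinearMap).starProjection (toHS n X))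

/-! ### Density matrices, norms and powers -/

/-- `ρ` is a density matrix of the algebra `M`. -/
structure IsDensityMatrix (M : StarSubalgebra ℂ (Matrix (Fin n) (Fin n) ℂ))
    (ρ : Matrix (Fin n) (Fin n) ℂ) : Prop where
  mem : ρ ∈ M
  posSemidef : ρ.PosSemidef
  trace_eq_one : ρ.trace = 1

/-- The square root `A^{1/2}` of a positive semidefinite matrix. -/
def sqrtMat (A : Matrix (Fin n) (Fin n) ℂ) : Matrix (Fin n) (Fin n) ℂ :=
  cfc Real.sqrt A

/-- The generalized inverse `A⁺ = ∑_{λ ≠ 0} λ⁻¹ P_λ` (recall `0⁻¹ = 0`). -/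
def genInv (A : Matrix (Fin n) (Fin n) ℂ) : Matrix (Fin n) (Fin n) ℂ :=
  cfc (fun x : ℝ => x⁻¹) A

/-- `A^{-1/2} = (A⁺)^{1/2}`. -/
def invSqrtMat (A : Matrix (Fin n) (Fin n) ℂ) : Matrix (Fin n) (Fin n) ℂ :=
  sqrtMat (genInv A)

/-- The trace norm `‖X‖₁`, the sum of the singular values of `X`. -/
def traceNorm (X : Matrix (Fin n) (Fin n) ℂ) : ℝ :=
  ∑ i, √((Matrix.isHermitian_conjTranspose_mul_self X).eigenvalues i)

/-- The operator norm `‖X‖`, the largest singular value of `X`. -/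
def opNorm (X : Matrix (Fin n) (Fin n) ℂ) : ℝ :=
  ‖Matrix.toEuclideanCLM (𝕜 := ℂ) X‖

/-- The smallest non-zero eigenvalue of a density matrix. -/
def minNonzeroEigenvalue (A : Matrix (Fin n) (Fin n) ℂ) : ℝ :=
  sInf {l : ℝ | l ∈ spectrum ℝ A ∧ l ≠ 0}

/-! ### The relative modular operator, quasi-entropies and the Petz recovery map -/

/-- The relative modular operator `Δ_{σ,ρ}(X) = σ X ρ⁺` on the Hilbert–Schmidt space. -/
def relModular (σ ρ : Matrix (Fin n) (Fin n) ℂ) : Module.End ℂ (HS n) :=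
  (toHS n).toLinearMap ∘ₗ LinearMap.mulLeft ℂ σ ∘ₗ LinearMap.mulRight ℂ (genInv ρ) ∘ₗ
    (toHS n).symm.toLinearMap

/-- The extension of a decreasing function `f` on `(0,∞)` to `[0,∞)` by its limit
`f(0+) = sup_{y > 0} f(y)`, which may be `+∞`. -/
def extendZero (f : ℝ → ℝ) (x : ℝ) : EReal :=
  if 0 < x then (f x : EReal) else ⨆ y : Set.Ioi (0 : ℝ), (f y : EReal)

/-- The `f`-relative quasi-entropy `S_f(ρ‖σ) = ⟨ρ^{1/2}, f(Δ_{σ,ρ}) ρ^{1/2}⟩`, that is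
`∑_z f(z) ‖P_z ρ^{1/2}‖²` over the (real, non-negative) eigenvalues `z` of `Δ_{σ,ρ}`, with `P_z` the
orthogonal projection onto the eigenspace of `z`, with `f(0) = f(0+)` and `∞ · 0 = 0`.
The value is never `-∞`; it is `+∞` iff `f(0+) = +∞` and `ker σ` is not contained in `ker ρ`. -/
def quasiEntropy (f : ℝ → ℝ) (ρ σ : Matrix (Fin n) (Fin n) ℂ) : EReal :=
  ∑ z ∈ (Module.End.finite_hasEigenvalue (relModular σ ρ)).toFinset,
    extendZero f z.re *
      ((‖(Module.End.eigenspace (relModular σ ρ) z).starProjection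
        (toHS n (sqrtMat ρ))‖ ^ 2 : ℝ) : EReal)

/-- The Petz recovery map `R_ρ(X) = ρ^{1/2} (ρ_N^{-1/2} X ρ_N^{-1/2}) ρ^{1/2}`. -/
def petz (N : StarSubalgebra ℂ (Matrix (Fin n) (Fin n) ℂ)) (ρ X : Matrix (Fin n) (Fin n) ℂ) :
    Matrix (Fin n) (Fin n) ℂ :=
  sqrtMat ρ * (invSqrtMat (hsCondExp N ρ) * X * invSqrtMat (hsCondExp N ρ)) * sqrtMat ρ

end QuasiEntropy

end

/-! Write Δ and Δ_N for the relative modular operators of (σ, ρ) and (σ_N, ρ_N). There is a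
contraction V on the Hilbert–Schmidt space with V*ΔV ≤ Δ_N, V*ρ^{1/2} = ρ_N^{1/2} and V(X) = X
ρ_N^{-1/2} ρ^{1/2} on N. The structure `Dominates` isolates what is needed of it. Completing the
square in the form of t + Δ bounds t‖V(t+Δ_N)⁻¹ρ_N^{1/2} − (t+Δ)⁻¹ρ^{1/2}‖² by the difference of the
two resolvent expectations (`Dominates.gap_ge`). Up to affine terms, which cancel, f is an integral
of 1/(t+x) against μ, so the entropy gap dominates the integral of these differences. This gives
data processing and also its stability.

The function to compare is the square root, because Δ^{1/2}ρ^{1/2} = σ^{1/2}, while V takes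
Δ_N^{1/2}ρ_N^{1/2} = σ_N^{1/2} to σ_N^{1/2}ρ_N^{-1/2}ρ^{1/2}, a square root of the recovered state.
In π√x = ∫ √t (1/t − 1/(t+x)) dt, the tails outside [1/T, T] cost O(T^{-1/2}), and inside dt is at
most about C T^{2c} dμ. Choosing T as a negative power of the gap gives `Dominates.stability`. The
estimate on square roots becomes a trace norm estimate by `traceNorm_sub_le`, and left
multiplication by ρ_N^{1/2}σ_N^{-1/2} exchanges ρ and σ (`mul_petzRoot_sub`).

Conversely, both the conditional expectation and the recovery map have the form X ↦ K E_N(X) K*,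
with K = 1 and K = τ^{1/2}τ_N^{-1/2}, so `dominates_of_channel` covers both. If one recovery map
restores both states, data processing for that map gives the reverse entropy inequality. -/

noncomputable section

namespace QuasiEntropy

/-! ### Functional calculus of a positive operator applied to a vector. -/

section SpectralCalculus

open Module.End

section Spectral

variable {H : Type*} [NormedAddCommGroup H] [InnerProductSpace ℂ H] [FiniteDimensional ℂ H]

/-- The finite set of eigenvalues. -/
def eigs (T : Module.End ℂ H) : Finset ℂ := (finite_hasEigenvalue T).toFinset

/-- The orthogonal projection onto an eigenspace. -/
def specProj (T : Module.End ℂ H) (z : ℂ) (u : H) : H := (eigenspace T z).starProjection u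

/-- The spectral measure of the vector `u` at `z`. -/
def specMass (T : Module.End ℂ H) (u : H) (z : ℂ) : ℝ := ‖specProj T z u‖ ^ 2

/-- The vector `g(T) u`. -/
def specMap (T : Module.End ℂ H) (g : ℝ → ℝ) (u : H) : H :=
  ∑ z ∈ eigs T, ((g z.re : ℝ) : ℂ) • specProj T z u

/-- The number `⟨u, g(T) u⟩`. -/
def specSum (T : Module.End ℂ H) (g : ℝ → ℝ) (u : H) : ℝ :=
  ∑ z ∈ eigs T, g z.re * specMass T u z

lemma mem_eigs {T : Module.End ℂ H} {z : ℂ} : z ∈ eigs T ↔ HasEigenvalue T z := by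
  simp [eigs]

lemma specMass_nonneg (T : Module.End ℂ H) (u : H) (z : ℂ) : 0 ≤ specMass T u z := sq_nonneg _

lemma specProj_mem (T : Module.End ℂ H) (z : ℂ) (u : H) : specProj T z u ∈ eigenspace T z :=
  Submodule.starProjection_apply_mem _ _

lemma apply_specProj (T : Module.End ℂ H) (z : ℂ) (u : H) :
    T (specProj T z u) = z • specProj T z u :=
  mem_eigenspace_iff.mp (specProj_mem T z u)

lemma im_eq_zero_of_mem_eigs {T : Module.End ℂ H} (hT : T.IsSymmetric) {z : ℂ}
    (hz : z ∈ eigs T) : ((z.re : ℝ) : ℂ) = z :=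
  Complex.conj_eq_iff_re.mp (hT.conj_eigenvalue_eq_self (mem_eigs.mp hz))

lemma re_nonneg_of_mem_eigs {T : Module.End ℂ H} (hT : T.IsPositive) {z : ℂ}
    (hz : z ∈ eigs T) : 0 ≤ z.re := by
  have h := mem_eigs.mp hz
  rw [← im_eq_zero_of_mem_eigs hT.1 hz] at h
  exact eigenvalue_nonneg_of_nonneg h fun x => hT.re_inner_nonneg_right x

lemma inner_specProj_of_ne {T : Module.End ℂ H} (hT : T.IsSymmetric) {z w : ℂ} (h : z ≠ w)
    (u v : H) : inner ℂ (specProj T z u) (specProj T w v) = 0 :=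
  hT.orthogonalFamily_eigenspaces h ⟨_, specProj_mem T z u⟩ ⟨_, specProj_mem T w v⟩

lemma sum_specProj {T : Module.End ℂ H} (hT : T.IsSymmetric) (u : H) :
    ∑ z ∈ eigs T, specProj T z u = u := by
  classical
  have h := hT.orthogonalFamily_eigenspaces'.sum_projection_of_mem_iSup u (by
    rw [Submodule.orthogonal_eq_bot_iff.mp hT.orthogonalComplement_iSup_eigenspaces_eq_bot']
    exact Submodule.mem_top)
  conv_rhs => rw [← h]
  exact Finset.sum_subtype (eigs T) (fun z => mem_eigs) fun z => specProj T z u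

lemma specMap_one {T : Module.End ℂ H} (hT : T.IsSymmetric) (u : H) :
    specMap T (fun _ => 1) u = u := by
  simpa [specMap] using sum_specProj hT u

lemma inner_specMap {T : Module.End ℂ H} (hT : T.IsSymmetric) (g h : ℝ → ℝ) (u : H) :
    inner ℂ (specMap T g u) (specMap T h u) = (specSum T (fun x => g x * h x) u : ℝ) := by
  classical
  simp only [specMap, specSum, sum_inner, inner_sum, inner_smul_left, inner_smul_right]
  push_cast
  refine Finset.sum_congr rfl fun z hz => ?_
  rw [Finset.sum_eq_single_of_mem z hz]
  · rw [inner_self_eq_norm_sq_to_K]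
    simp [specMass]
    ring
  · intro w _ hw
    rw [inner_specProj_of_ne hT hw]
    simp

lemma inner_left_specMap {T : Module.End ℂ H} (hT : T.IsSymmetric) (h : ℝ → ℝ) (u : H) :
    inner ℂ u (specMap T h u) = (specSum T h u : ℝ) := by
  have := inner_specMap hT (fun _ => 1) h u
  simpa [specMap_one hT] using this

lemma norm_sq_specMap {T : Module.End ℂ H} (hT : T.IsSymmetric) (g : ℝ → ℝ) (u : H) :
    ‖specMap T g u‖ ^ 2 = specSum T (fun x => g x ^ 2) u := by
  have := inner_specMap hT g g u
  rw [inner_self_eq_norm_sq_to_K] at this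
  have h2 : ((‖specMap T g u‖ ^ 2 : ℝ) : ℂ) = (specSum T (fun x => g x * g x) u : ℝ) := by
    push_cast; exact this
  simpa [sq] using Complex.ofReal_injective h2

lemma specSum_one {T : Module.End ℂ H} (hT : T.IsSymmetric) (u : H) :
    specSum T (fun _ => 1) u = ‖u‖ ^ 2 := by
  have := norm_sq_specMap hT (fun _ => 1) u
  rw [specMap_one hT] at this
  simp [this]

lemma sum_specMass {T : Module.End ℂ H} (hT : T.IsSymmetric) (u : H) :
    ∑ z ∈ eigs T, specMass T u z = ‖u‖ ^ 2 := by
  simpa [specSum] using specSum_one hT u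

lemma apply_specMap {T : Module.End ℂ H} (hT : T.IsSymmetric) (g : ℝ → ℝ) (u : H) :
    T (specMap T g u) = specMap T (fun x => x * g x) u := by
  simp only [specMap, map_sum, map_smul, apply_specProj]
  refine Finset.sum_congr rfl fun z hz => ?_
  rw [smul_smul]
  congr 1
  conv_lhs => rw [← im_eq_zero_of_mem_eigs hT hz]
  push_cast
  simp [mul_comm]

lemma specMap_id {T : Module.End ℂ H} (hT : T.IsSymmetric) (u : H) :
    specMap T (fun x => x) u = T u := by
  have := apply_specMap hT (fun _ => 1) u
  rw [specMap_one hT] at this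
  simp [this]

lemma specMap_congr {T : Module.End ℂ H} (hT : T.IsPositive) {g h : ℝ → ℝ}
    (hgh : ∀ x, 0 ≤ x → g x = h x) (u : H) : specMap T g u = specMap T h u :=
  Finset.sum_congr rfl fun _ hz => by rw [hgh _ (re_nonneg_of_mem_eigs hT hz)]

lemma specSum_mono {T : Module.End ℂ H} (hT : T.IsPositive) {g h : ℝ → ℝ}
    (hgh : ∀ x, 0 ≤ x → g x ≤ h x) (u : H) : specSum T g u ≤ specSum T h u :=
  Finset.sum_le_sum fun z hz => mul_le_mul_of_nonneg_right
    (hgh _ (re_nonneg_of_mem_eigs hT hz)) (specMass_nonneg T u z)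

lemma specMap_add (T : Module.End ℂ H) (g h : ℝ → ℝ) (u : H) :
    specMap T (fun x => g x + h x) u = specMap T g u + specMap T h u := by
  simp [specMap, add_smul, Finset.sum_add_distrib]

lemma specMap_sub (T : Module.End ℂ H) (g h : ℝ → ℝ) (u : H) :
    specMap T (fun x => g x - h x) u = specMap T g u - specMap T h u := by
  simp [specMap, sub_smul, Finset.sum_sub_distrib]

lemma specMap_const_mul (T : Module.End ℂ H) (r : ℝ) (g : ℝ → ℝ) (u : H) :
    specMap T (fun x => r * g x) u = (r : ℂ) • specMap T g u := by
  simp [specMap, mul_smul, Finset.smul_sum]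

lemma norm_specMap_le {T : Module.End ℂ H} (hT : T.IsPositive) {g h : ℝ → ℝ}
    (hg : ∀ x, 0 ≤ x → 0 ≤ g x) (hgh : ∀ x, 0 ≤ x → g x ≤ h x) (u : H) :
    ‖specMap T g u‖ ≤ ‖specMap T h u‖ := by
  refine le_of_sq_le_sq ?_ (norm_nonneg _)
  rw [norm_sq_specMap hT.1, norm_sq_specMap hT.1]
  exact specSum_mono hT (fun x hx => pow_le_pow_left₀ (hg x hx) (hgh x hx) 2) u

/-- A positive square root of `T` acts on vectors as the square root in the functional calculus. -/
lemma specMap_sqrt {T S : Module.End ℂ H} (hT : T.IsPositive) (hS : S.IsPositive)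
    (h : ∀ x, S (S x) = T x) (u : H) : specMap T Real.sqrt u = S u := by
  conv_rhs => rw [← sum_specProj hT.1 u, map_sum]
  refine Finset.sum_congr rfl fun z hz => ?_
  set x := specProj T z u with hx
  have hTx : S (S x) = (z.re : ℂ) • x := by
    rw [h, hx, apply_specProj, im_eq_zero_of_mem_eigs hT.1 hz]
  have hz0 := re_nonneg_of_mem_eigs hT hz
  rcases hz0.eq_or_lt with h0 | h0
  · rw [← h0] at hTx ⊢
    have : inner ℂ (S x) (S x) = 0 := by
      rw [hS.1, hTx]; simp
    rw [inner_self_eq_zero.mp this]; simp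
  · set r := √z.re with hr
    have hr0 : 0 < r := Real.sqrt_pos.mpr h0
    have hrr : (z.re : ℂ) = (r : ℂ) * r := by
      rw [← Complex.ofReal_mul, Real.mul_self_sqrt hz0]
    -- Since (S + r)(S − r)x = 0, the vector y satisfies S y = −r y, and positivity of S forces y =
    -- 0.
    set y := S x - (r : ℂ) • x with hy
    have hSy : S y = -((r : ℂ) • y) := by
      rw [hy, map_sub, map_smul, hTx, hrr, mul_smul, smul_sub]; abel
    have h1 := hS.re_inner_nonneg_right y
    rw [hSy, inner_neg_right, inner_smul_right, inner_self_eq_norm_sq_to_K] at h1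
    have h2 : 0 ≤ -(r * ‖y‖ ^ 2) := by
      have : RCLike.re (-((r : ℂ) * ((‖y‖ : ℝ) : ℂ) ^ 2)) = -(r * ‖y‖ ^ 2) := by
        rw [← Complex.ofReal_pow, ← Complex.ofReal_mul, ← Complex.ofReal_neg]; rfl
      rw [← this]; exact h1
    have h3 : ‖y‖ ^ 2 = 0 := by
      have := sq_nonneg ‖y‖
      nlinarith
    have : y = 0 := by simpa using h3
    exact (sub_eq_zero.mp this).symm

end Spectral

end SpectralCalculus

/-! ### Integral representation of f and the abstract data processing inequality. -/

section PickFunctions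

open Filter Topology

section Kernel

/-- The kernel of the canonical integral representation. -/
def pickKernel (x t : ℝ) : ℝ := t / (t ^ 2 + 1) - 1 / (t + x)

lemma measurable_pickKernel (x : ℝ) : Measurable (pickKernel x) := by
  unfold pickKernel; fun_prop

/-- Over a common denominator the kernel is (tx − 1)/((t + x)(t² + 1)). The resulting bound is
locally uniform in x > 0, which serves both integrability and dominated convergence. -/
lemma abs_pickKernel_le {x t : ℝ} (hx : 0 < x) (ht : 0 < t) :
    |pickKernel x t| ≤ (x + 1 / x) * (1 / (t ^ 2 + 1)) := by
  have h1 : pickKernel x t = (t * x - 1) / (t + x) * (1 / (t ^ 2 + 1)) := by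
    unfold pickKernel; field_simp; ring
  rw [h1, abs_mul, abs_of_pos (by positivity : 0 < 1 / (t ^ 2 + 1))]
  refine mul_le_mul_of_nonneg_right ?_ (by positivity)
  rw [abs_div, abs_of_pos (by positivity : 0 < t + x), div_le_iff₀ (by positivity)]
  have h2 : (x + 1 / x) * (t + x) = x * t + x ^ 2 + t / x + 1 := by field_simp; ring
  rw [h2, abs_le]
  have : 0 < t / x := by positivity
  constructor <;> nlinarith [mul_pos hx ht]

variable {f : ℝ → ℝ} {a b : ℝ} {μ : Measure ℝ}

lemma CanonicalRepresentation.ae_pos (h : CanonicalRepresentation (fun x => -f x) a b μ) :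
    ∀ᵐ t ∂μ, 0 < t := by
  have : {t : ℝ | ¬ 0 < t} = Set.Iic 0 := by ext; simp
  rw [ae_iff, this]; exact h.measure_Iic_zero

lemma CanonicalRepresentation.integrable_pickKernel
    (h : CanonicalRepresentation (fun x => -f x) a b μ) {x : ℝ} (hx : 0 < x) :
    Integrable (pickKernel x) μ := by
  refine (h.integrable.const_mul (x + 1 / x)).mono' (measurable_pickKernel x).aestronglyMeasurable ?_
  filter_upwards [h.ae_pos] with t ht using abs_pickKernel_le hx ht

lemma CanonicalRepresentation.eq (h : CanonicalRepresentation (fun x => -f x) a b μ) {x : ℝ}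
    (hx : 0 < x) : f x = -(a * x + b) - ∫ t, pickKernel x t ∂μ := by
  have := h.eq_integral x hx
  simp only [pickKernel]
  linarith

lemma CanonicalRepresentation.antitoneOn (h : CanonicalRepresentation (fun x => -f x) a b μ) :
    AntitoneOn f (Set.Ioi 0) := by
  intro x hx y hy hxy
  have hx' : 0 < x := hx
  have hy' : 0 < y := hy
  rw [h.eq hx, h.eq hy]
  have h1 : ∫ t, pickKernel x t ∂μ ≤ ∫ t, pickKernel y t ∂μ := by
    refine integral_mono_ae (h.integrable_pickKernel hx) (h.integrable_pickKernel hy) ?_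
    filter_upwards [h.ae_pos] with t ht
    have : 1 / (t + y) ≤ 1 / (t + x) := one_div_le_one_div_of_le (by positivity) (by linarith)
    simp only [pickKernel]; linarith
  have := mul_le_mul_of_nonneg_left hxy h.nonneg
  linarith

lemma CanonicalRepresentation.continuousAt (h : CanonicalRepresentation (fun x => -f x) a b μ)
    {x : ℝ} (hx : 0 < x) : ContinuousAt f x := by
  have h1 : ContinuousAt (fun y => ∫ t, pickKernel y t ∂μ) x := by
    have hev : ∀ᶠ y in 𝓝 x, y ∈ Set.Ioo (x / 2) (2 * x) :=
      Ioo_mem_nhds (by linarith) (by linarith)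
    refine continuousAt_of_dominated (bound := fun t => (2 * x + 2 / x) * (1 / (t ^ 2 + 1)))
      (Eventually.of_forall fun y => (measurable_pickKernel y).aestronglyMeasurable) ?_
      (h.integrable.const_mul _) ?_
    · filter_upwards [hev] with y hy
      filter_upwards [h.ae_pos] with t ht
      have hy0 : 0 < y := by linarith [hy.1]
      refine (abs_pickKernel_le hy0 ht).trans (mul_le_mul_of_nonneg_right ?_ (by positivity))
      have : 1 / y ≤ 2 / x := by
        rw [div_le_div_iff₀ hy0 hx]; linarith [hy.1]
      linarith [hy.2]
    · filter_upwards [h.ae_pos] with t ht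
      have : t + x ≠ 0 := by positivity
      unfold pickKernel
      fun_prop (disch := assumption)
  have h2 : ContinuousAt (fun y => -(a * y + b) - ∫ t, pickKernel y t ∂μ) x := by fun_prop
  refine h2.congr ?_
  filter_upwards [Ioi_mem_nhds hx] with y hy using (h.eq hy).symm

/-- Shifting the argument by ε > 0 keeps all values real even when f(0+) = +∞. At x = 0 the right
limit of an antitone function is its supremum; elsewhere continuity applies. -/
lemma CanonicalRepresentation.tendsto_extendZero
    (h : CanonicalRepresentation (fun x => -f x) a b μ) {x : ℝ} (hx : 0 ≤ x) :
    Tendsto (fun ε : ℝ => (f (x + ε) : EReal)) (𝓝[>] 0) (𝓝 (extendZero f x)) := by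
  rcases hx.eq_or_lt with h0 | h0
  · subst h0
    have : AntitoneOn (fun y => (f y : EReal)) (Set.Ioi 0) := fun x hx y hy hxy =>
      EReal.coe_le_coe_iff.mpr (h.antitoneOn hx hy hxy)
    have h1 := this.tendsto_nhdsGT (OrderTop.bddAbove _)
    simpa [extendZero, sSup_image'] using h1
  · rw [extendZero, if_pos h0]
    refine EReal.tendsto_coe.mpr ?_
    have h1 : Tendsto (fun ε : ℝ => x + ε) (𝓝[>] 0) (𝓝 x) := by
      have : Tendsto (fun ε : ℝ => x + ε) (𝓝 0) (𝓝 (x + 0)) := by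
        exact (continuous_const.add continuous_id).tendsto 0
      rw [add_zero] at this
      exact this.mono_left nhdsWithin_le_nhds
    exact (h.continuousAt h0).tendsto.comp h1

lemma extendZero_ne_bot (f : ℝ → ℝ) (x : ℝ) : extendZero f x ≠ ⊥ := by
  unfold extendZero
  split_ifs
  · exact EReal.coe_ne_bot _
  · refine ne_of_gt (lt_of_lt_of_le (EReal.bot_lt_coe (f 1)) ?_)
    exact le_iSup (fun y : Set.Ioi (0 : ℝ) => (f y : EReal)) ⟨1, Set.mem_Ioi.mpr one_pos⟩

end Kernel

section Entropy

variable {H : Type*} [NormedAddCommGroup H] [InnerProductSpace ℂ H] [FiniteDimensional ℂ H]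
  {f : ℝ → ℝ} {a b : ℝ} {μ : Measure ℝ}

/-- The quasi-entropy `⟨u, f(T) u⟩` of a positive operator and a vector. -/
def specEntropy (f : ℝ → ℝ) (T : Module.End ℂ H) (u : H) : EReal :=
  ∑ z ∈ eigs T, extendZero f z.re * ((specMass T u z : ℝ) : EReal)

lemma extendZero_mul_ne_bot (f : ℝ → ℝ) (x : ℝ) {p : ℝ} (hp : 0 ≤ p) :
    extendZero f x * (p : EReal) ≠ ⊥ := by
  rcases hp.eq_or_lt with h0 | h0
  · simp [← h0]
  · induction h : extendZero f x with
    | bot => exact absurd h (extendZero_ne_bot f x)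
    | coe y => rw [← EReal.coe_mul]; exact EReal.coe_ne_bot _
    | top => rw [EReal.top_mul_coe_of_pos h0]; simp

lemma sum_ne_bot {ι : Type*} (s : Finset ι) (g : ι → EReal) (h : ∀ i ∈ s, g i ≠ ⊥) :
    ∑ i ∈ s, g i ≠ ⊥ := by
  classical
  induction s using Finset.induction_on with
  | empty => simp
  | insert i s hi ih =>
    rw [Finset.sum_insert hi]
    exact EReal.add_ne_bot_iff.mpr ⟨h i (by simp), ih fun j hj => h j (by simp [hj])⟩

lemma specEntropy_ne_bot (f : ℝ → ℝ) (T : Module.End ℂ H) (u : H) : specEntropy f T u ≠ ⊥ :=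
  sum_ne_bot _ _ fun z _ => extendZero_mul_ne_bot f z.re (specMass_nonneg T u z)

/-- Addition of extended reals is continuous away from the pairs (⊥, ⊤) and (⊤, ⊥), so excluding ⊥
from the limits suffices. -/
lemma tendsto_sum_ereal {ι α : Type*} {l : Filter α} (s : Finset ι) (g : ι → α → EReal)
    (L : ι → EReal) (h : ∀ i ∈ s, Tendsto (g i) l (𝓝 (L i))) (hL : ∀ i ∈ s, L i ≠ ⊥) :
    Tendsto (fun x => ∑ i ∈ s, g i x) l (𝓝 (∑ i ∈ s, L i)) := by
  classical
  induction s using Finset.induction_on with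
  | empty => simpa using tendsto_const_nhds
  | insert i s hi ih =>
    simp only [Finset.sum_insert hi]
    have hb := sum_ne_bot s L fun j hj => hL j (by simp [hj])
    have hc := EReal.continuousAt_add (p := (L i, ∑ j ∈ s, L j)) (Or.inr hb)
      (Or.inl (hL i (by simp)))
    exact hc.tendsto.comp ((h i (by simp)).prodMk_nhds
      (ih (fun j hj => h j (by simp [hj])) fun j hj => hL j (by simp [hj])))

/-- The quasi-entropy is the limit of the regularized ones. -/
lemma tendsto_specEntropy (h : CanonicalRepresentation (fun x => -f x) a b μ)
    {T : Module.End ℂ H} (hT : T.IsPositive) (u : H) :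
    Tendsto (fun ε : ℝ => ((specSum T (fun x => f (x + ε)) u : ℝ) : EReal)) (𝓝[>] 0)
      (𝓝 (specEntropy f T u)) := by
  have hcoe : ∀ (s : Finset ℂ) (g : ℂ → ℝ), ((∑ z ∈ s, g z : ℝ) : EReal) = ∑ z ∈ s, (g z : EReal) :=
    fun s g => map_sum (⟨⟨Real.toEReal, rfl⟩, EReal.coe_add⟩ : ℝ →+ EReal) g s
  simp only [specSum, hcoe]
  refine tendsto_sum_ereal _ _ _ (fun z hz => ?_) fun z _ =>
    extendZero_mul_ne_bot f z.re (specMass_nonneg T u z)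
  have h1 := h.tendsto_extendZero (re_nonneg_of_mem_eigs hT hz)
  simp only [EReal.coe_mul]
  rcases (specMass_nonneg T u z).eq_or_lt with h0 | h0
  · simp [← h0]
  · refine EReal.Tendsto.mul_const h1 (Or.inr (EReal.coe_ne_bot _)) (Or.inr (EReal.coe_ne_top _))

lemma tendsto_specEntropy_toReal (h : CanonicalRepresentation (fun x => -f x) a b μ)
    {T : Module.End ℂ H} (hT : T.IsPositive) (u : H) (hne : specEntropy f T u ≠ ⊤) :
    Tendsto (fun ε : ℝ => specSum T (fun x => f (x + ε)) u) (𝓝[>] 0)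
      (𝓝 (specEntropy f T u).toReal) := by
  have := (EReal.tendsto_toReal hne (specEntropy_ne_bot f T u)).comp (tendsto_specEntropy h hT u)
  simpa [Function.comp_def] using this

/-- The function `t ↦ ⟨u, (t + T)⁻¹ u⟩`. -/
def resSum (T : Module.End ℂ H) (u : H) (t : ℝ) : ℝ := specSum T (fun x => 1 / (t + x)) u

/-- The vector `(t + T)⁻¹ u`. -/
def resolv (T : Module.End ℂ H) (u : H) (t : ℝ) : H := specMap T (fun x => 1 / (t + x)) u

lemma measurable_resSum (T : Module.End ℂ H) (u : H) : Measurable (resSum T u) := by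
  unfold resSum specSum; fun_prop

lemma continuousAt_resSum {T : Module.End ℂ H} (hT : T.IsPositive) (u : H) {t : ℝ} (ht : 0 < t) :
    ContinuousAt (resSum T u) t := by
  unfold resSum specSum
  refine tendsto_finsetSum _ fun z hz => ?_
  have : t + z.re ≠ 0 := by have := re_nonneg_of_mem_eigs hT hz; positivity
  have h2 : ContinuousAt (fun t => 1 / (t + z.re) * specMass T u z) t := by
    fun_prop (disch := assumption)
  exact h2

lemma continuousOn_resolv {T : Module.End ℂ H} (hT : T.IsPositive) (u : H) :
    ContinuousOn (resolv T u) (Set.Ioi 0) := by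
  unfold resolv specMap
  refine continuousOn_finsetSum _ fun z hz => ?_
  refine ContinuousOn.smul ?_ continuousOn_const
  refine Complex.continuous_ofReal.comp_continuousOn ?_
  refine ContinuousOn.div continuousOn_const (by fun_prop) fun t ht => ?_
  have := re_nonneg_of_mem_eigs hT hz
  have ht : 0 < t := ht
  positivity

lemma apply_resolv {T : Module.End ℂ H} (hT : T.IsPositive) (u : H) {t : ℝ} (ht : 0 < t) :
    T (resolv T u t) = u - (t : ℂ) • resolv T u t := by
  rw [resolv, apply_specMap hT.1, ← specMap_const_mul]
  conv_rhs => lhs; rw [← specMap_one hT.1 u]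
  rw [← specMap_sub]
  refine specMap_congr hT (fun x hx => ?_) u
  field_simp
  ring

/-- The regularizing term t/(t² + 1) sees only the total mass ‖u‖², so it cancels between two
vectors of equal norm. -/
lemma specSum_pick {T : Module.End ℂ H} (hT : T.IsPositive) (u : H) (ε t : ℝ) :
    ∑ z ∈ eigs T, pickKernel (z.re + ε) t * specMass T u z =
      t / (t ^ 2 + 1) * ‖u‖ ^ 2 - resSum T u (t + ε) := by
  rw [← sum_specMass hT.1, resSum, specSum, Finset.mul_sum, ← Finset.sum_sub_distrib]
  refine Finset.sum_congr rfl fun z _ => ?_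
  rw [pickKernel, sub_mul]
  congr 3; ring

lemma integrable_specSum_pick (h : CanonicalRepresentation (fun x => -f x) a b μ)
    {T : Module.End ℂ H} (hT : T.IsPositive) (u : H) {ε : ℝ} (hε : 0 < ε) :
    Integrable (fun t => ∑ z ∈ eigs T, pickKernel (z.re + ε) t * specMass T u z) μ := by
  refine integrable_finsetSum _ fun z hz => Integrable.mul_const ?_ _
  exact h.integrable_pickKernel (by have := re_nonneg_of_mem_eigs hT hz; positivity)

lemma specSum_shift (h : CanonicalRepresentation (fun x => -f x) a b μ)
    {T : Module.End ℂ H} (hT : T.IsPositive) (u : H) {ε : ℝ} (hε : 0 < ε) :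
    specSum T (fun x => f (x + ε)) u = -a * specSum T (fun x => x) u - (a * ε + b) * ‖u‖ ^ 2
      - ∫ t, ∑ z ∈ eigs T, pickKernel (z.re + ε) t * specMass T u z ∂μ := by
  have hpos : ∀ z ∈ eigs T, 0 < z.re + ε := fun z hz => by
    have := re_nonneg_of_mem_eigs hT hz; positivity
  rw [integral_finsetSum _ fun z hz => (h.integrable_pickKernel (hpos z hz)).mul_const _,
    ← sum_specMass hT.1, specSum, specSum, Finset.mul_sum, Finset.mul_sum,
    ← Finset.sum_sub_distrib, ← Finset.sum_sub_distrib]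
  refine Finset.sum_congr rfl fun z hz => ?_
  rw [h.eq (hpos z hz), integral_mul_const]
  ring

/-- The hypotheses under which the quasi-entropy of `(T₁, u₁)` dominates that of `(T₂, u₂)`. -/
structure Dominates (T₁ T₂ : Module.End ℂ H) (u₁ u₂ : H) (V : H →ₗ[ℂ] H) : Prop where
  pos₁ : T₁.IsPositive
  pos₂ : T₂.IsPositive
  norm_le : ∀ x, ‖V x‖ ≤ ‖x‖
  inner_eq : ∀ x, inner ℂ (V x) u₁ = inner ℂ x u₂
  form_le : ∀ x, (inner ℂ (V x) (T₁ (V x))).re ≤ (inner ℂ x (T₂ x)).re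
  norm_eq : ‖u₁‖ = ‖u₂‖
  moment_eq : specSum T₁ (fun x => x) u₁ = specSum T₂ (fun x => x) u₂

variable {T₁ T₂ : Module.End ℂ H} {u₁ u₂ : H} {V : H →ₗ[ℂ] H}

/-- The gap of the resolvent forms dominates the defect of `V` on the resolvent vectors. -/
lemma Dominates.gap_ge (hD : Dominates T₁ T₂ u₁ u₂ V) {t : ℝ} (ht : 0 < t) :
    t * ‖V (resolv T₂ u₂ t) - resolv T₁ u₁ t‖ ^ 2 ≤ resSum T₁ u₁ t - resSum T₂ u₂ t := by
  have e1 : resSum T₁ u₁ t = (inner ℂ (resolv T₁ u₁ t) u₁).re := by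
    rw [← inner_conj_symm, resolv, inner_left_specMap hD.pos₁.1]; simp [resSum]
  have e2 : resSum T₂ u₂ t = (inner ℂ (resolv T₂ u₂ t) u₂).re := by
    rw [← inner_conj_symm, resolv, inner_left_specMap hD.pos₂.1]; simp [resSum]
  have hx := apply_resolv hD.pos₁ u₁ ht
  have hy := apply_resolv hD.pos₂ u₂ ht
  rw [e1, e2]
  set x := resolv T₁ u₁ t
  set y := resolv T₂ u₂ t
  have hform := hD.form_le y
  have hnorm := pow_le_pow_left₀ (norm_nonneg _) (hD.norm_le y) 2
  have hin := congrArg Complex.re (hD.inner_eq y)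
  -- The form of t + T₁ at V y − x, expanded with (t + T₁)x = u₁, is at most ⟨x, u₁⟩ − ⟨y, u₂⟩ by
  -- the properties of V. Positivity of T₁ then leaves t‖V y − x‖² as a lower bound.
  have hp : 0 ≤ (inner ℂ (V y - x) (T₁ (V y - x))).re := hD.pos₁.re_inner_nonneg_right _
  have nsq : ∀ v : H, ‖v‖ ^ 2 = (inner ℂ v v).re := fun v => by
    rw [inner_self_eq_norm_sq_to_K]; norm_cast
  have hs : inner ℂ x (T₁ (V y)) = inner ℂ (T₁ x) (V y) := (hD.pos₁.1 _ _).symm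
  rw [map_sub] at hp
  simp only [inner_sub_left, inner_sub_right, hs, hx, hy, inner_smul_left, inner_smul_right,
    nsq, Complex.sub_re, Complex.conj_ofReal, Complex.re_ofReal_mul] at hp hform hnorm ⊢
  have c1 : (inner ℂ u₁ (V y)).re = (inner ℂ (V y) u₁).re :=
    inner_re_symm (𝕜 := ℂ) _ _
  have c2 : (inner ℂ x (V y)).re = (inner ℂ (V y) x).re :=
    inner_re_symm (𝕜 := ℂ) _ _
  rw [c1, c2] at hp
  rw [c2]
  have := mul_le_mul_of_nonneg_left hnorm ht.le
  linarith

lemma Dominates.gap_nonneg (hD : Dominates T₁ T₂ u₁ u₂ V) {t : ℝ} (ht : 0 < t) :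
    0 ≤ resSum T₁ u₁ t - resSum T₂ u₂ t :=
  le_trans (by positivity) (hD.gap_ge ht)

/-- Equal norms cancel b and t/(t² + 1), and equal first moments cancel the linear part a x. Only
the resolvents remain. -/
lemma Dominates.specSum_shift_sub (hD : Dominates T₁ T₂ u₁ u₂ V)
    (h : CanonicalRepresentation (fun x => -f x) a b μ) {ε : ℝ} (hε : 0 < ε) :
    Integrable (fun t => resSum T₁ u₁ (t + ε) - resSum T₂ u₂ (t + ε)) μ ∧
    specSum T₁ (fun x => f (x + ε)) u₁ - specSum T₂ (fun x => f (x + ε)) u₂ =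
      ∫ t, (resSum T₁ u₁ (t + ε) - resSum T₂ u₂ (t + ε)) ∂μ := by
  have i1 := integrable_specSum_pick h hD.pos₁ u₁ hε
  have i2 := integrable_specSum_pick h hD.pos₂ u₂ hε
  have e : (fun t => resSum T₁ u₁ (t + ε) - resSum T₂ u₂ (t + ε)) = fun t =>
      (∑ z ∈ eigs T₂, pickKernel (z.re + ε) t * specMass T₂ u₂ z) -
      ∑ z ∈ eigs T₁, pickKernel (z.re + ε) t * specMass T₁ u₁ z := by
    funext t
    rw [specSum_pick hD.pos₁, specSum_pick hD.pos₂, hD.norm_eq]; ring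
  rw [e]
  refine ⟨i2.sub i1, ?_⟩
  rw [integral_sub i2 i1, specSum_shift h hD.pos₁ u₁ hε, specSum_shift h hD.pos₂ u₂ hε,
    hD.norm_eq, hD.moment_eq]
  ring

lemma Dominates.specSum_shift_le (hD : Dominates T₁ T₂ u₁ u₂ V)
    (h : CanonicalRepresentation (fun x => -f x) a b μ) {ε : ℝ} (hε : 0 < ε) :
    specSum T₂ (fun x => f (x + ε)) u₂ ≤ specSum T₁ (fun x => f (x + ε)) u₁ := by
  rw [← sub_nonneg, (hD.specSum_shift_sub h hε).2]
  refine integral_nonneg_of_ae ?_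
  filter_upwards [h.ae_pos] with t ht using hD.gap_nonneg (add_pos ht hε)

/-- Data processing inequality. -/
lemma Dominates.specEntropy_le (hD : Dominates T₁ T₂ u₁ u₂ V)
    (h : CanonicalRepresentation (fun x => -f x) a b μ) :
    specEntropy f T₂ u₂ ≤ specEntropy f T₁ u₁ := by
  refine le_of_tendsto_of_tendsto (tendsto_specEntropy h hD.pos₂ u₂)
    (tendsto_specEntropy h hD.pos₁ u₁) ?_
  filter_upwards [self_mem_nhdsWithin] with ε hε
  exact EReal.coe_le_coe_iff.mpr (hD.specSum_shift_le h hε)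

/-- The entropy gap dominates the integral of the resolvent gap. -/
lemma Dominates.lintegral_gap_le (hD : Dominates T₁ T₂ u₁ u₂ V)
    (h : CanonicalRepresentation (fun x => -f x) a b μ) (hne : specEntropy f T₁ u₁ ≠ ⊤) :
    ∫⁻ t, ENNReal.ofReal (resSum T₁ u₁ t - resSum T₂ u₂ t) ∂μ ≤
      ENNReal.ofReal ((specEntropy f T₁ u₁).toReal - (specEntropy f T₂ u₂).toReal) := by
  have hne2 : specEntropy f T₂ u₂ ≠ ⊤ := ne_top_of_le_ne_top hne (hD.specEntropy_le h)
  have hlim := ENNReal.tendsto_ofReal ((tendsto_specEntropy_toReal h hD.pos₁ u₁ hne).sub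
    (tendsto_specEntropy_toReal h hD.pos₂ u₂ hne2))
  -- Fatou along ε ↓ 0 gives an inequality in the direction needed and requires no dominating
  -- function.
  have hF := lintegral_liminf_le (μ := μ) (u := 𝓝[>] (0 : ℝ))
    (f := fun ε t => ENNReal.ofReal (resSum T₁ u₁ (t + ε) - resSum T₂ u₂ (t + ε))) (fun ε => by
      have h1 := measurable_resSum T₁ u₁
      have h2 := measurable_resSum T₂ u₂
      fun_prop)
  calc ∫⁻ t, ENNReal.ofReal (resSum T₁ u₁ t - resSum T₂ u₂ t) ∂μ
      = ∫⁻ t, liminf (fun ε => ENNReal.ofReal (resSum T₁ u₁ (t + ε) - resSum T₂ u₂ (t + ε)))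
          (𝓝[>] 0) ∂μ := by
        refine lintegral_congr_ae ?_
        filter_upwards [h.ae_pos] with t ht
        have hsh : Tendsto (fun ε : ℝ => t + ε) (𝓝[>] 0) (𝓝 t) := by
          have : Tendsto (fun ε : ℝ => t + ε) (𝓝 0) (𝓝 (t + 0)) :=
            (continuous_const.add continuous_id).tendsto 0
          rw [add_zero] at this
          exact this.mono_left nhdsWithin_le_nhds
        exact (ENNReal.tendsto_ofReal
          (((continuousAt_resSum hD.pos₁ u₁ ht).tendsto.comp hsh).sub
            ((continuousAt_resSum hD.pos₂ u₂ ht).tendsto.comp hsh))).liminf_eq.symm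
    _ ≤ _ := hF
    _ = liminf (fun ε => ENNReal.ofReal (specSum T₁ (fun x => f (x + ε)) u₁ -
          specSum T₂ (fun x => f (x + ε)) u₂)) (𝓝[>] 0) := by
        refine liminf_congr ?_
        filter_upwards [self_mem_nhdsWithin] with ε hε
        obtain ⟨hi, he⟩ := hD.specSum_shift_sub h hε
        rw [he, ofReal_integral_eq_lintegral_ofReal hi]
        filter_upwards [h.ae_pos] with t ht using hD.gap_nonneg (add_pos ht hε)
    _ = _ := hlim.liminf_eq

end Entropy

end PickFunctions

/-! ### From resolvents to square roots, and quantitative stability. -/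

section SquareRootEstimate

open Filter Topology

section SquareRoot

/-- The truncated integral representation of `π √x`. -/
def sqrtTrunc (T x : ℝ) : ℝ := ∫ t in T⁻¹..T, √t * (1 / t - 1 / (t + x))

lemma arctan_le_self {x : ℝ} (hx : 0 ≤ x) : Real.arctan x ≤ x := by
  rcases le_or_gt (Real.pi / 2) x with h | h
  · exact (Real.arctan_lt_pi_div_two x).le.trans h
  · have h1 := Real.le_tan hx h
    have h2 := Real.arctan_mono h1
    rwa [Real.arctan_tan (by linarith [Real.pi_pos]) h] at h2

lemma continuousOn_sqrt_kernel {x : ℝ} (hx : 0 ≤ x) :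
    ContinuousOn (fun t : ℝ => √t * (1 / t - 1 / (t + x))) (Set.Ioi 0) := by
  have h1 : ∀ t ∈ Set.Ioi (0 : ℝ), t ≠ 0 := fun t ht => (Set.mem_Ioi.mp ht).ne'
  have h2 : ∀ t ∈ Set.Ioi (0 : ℝ), t + x ≠ 0 := fun t ht => by
    have : 0 < t := ht
    positivity
  fun_prop (disch := assumption)

lemma uIcc_subset_Ioi {T : ℝ} (hT : 0 < T) : Set.uIcc T⁻¹ T ⊆ Set.Ioi 0 := fun _ ht =>
  lt_of_lt_of_le (lt_min (inv_pos.mpr hT) hT) ht.1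

/-- The substitution t = x s² turns the integrand into 2√x/(1 + s²). -/
lemma sqrtTrunc_eq {T x : ℝ} (hT : 0 < T) (hx : 0 < x) :
    sqrtTrunc T x = 2 * √x * Real.arctan (√T / √x) - 2 * √x * Real.arctan (√T⁻¹ / √x) := by
  refine intervalIntegral.integral_eq_sub_of_hasDerivAt
    (f := fun t => 2 * √x * Real.arctan (√t / √x)) (fun t ht => ?_)
    ((continuousOn_sqrt_kernel hx.le).mono (uIcc_subset_Ioi hT)).intervalIntegrable
  have ht0 : 0 < t := uIcc_subset_Ioi hT ht
  have h1 := (((Real.hasDerivAt_sqrt ht0.ne').div_const √x).arctan).const_mul (2 * √x)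
  convert! h1 using 1
  have hsx : 0 < √x := Real.sqrt_pos.mpr hx
  have hst : 0 < √t := Real.sqrt_pos.mpr ht0
  have ex : √x ^ 2 = x := Real.sq_sqrt hx.le
  have et : √t ^ 2 = t := Real.sq_sqrt ht0.le
  have : (√t / √x) ^ 2 = t / x := by rw [div_pow, ex, et]
  rw [this]
  field_simp
  rw [et]
  ring

/-- The reflection arctan p + arctan(1/p) = π/2 writes the missing tails as arctangents of small
arguments. The tail t > T costs at most 2x/√T and the tail t < 1/T at most 2/√T. -/
lemma sqrtTrunc_bounds {T x : ℝ} (hT : 0 < T) (hx : 0 ≤ x) :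
    0 ≤ Real.pi * √x - sqrtTrunc T x ∧
      Real.pi * √x - sqrtTrunc T x ≤ 2 / √T * (1 + x) := by
  rcases hx.eq_or_lt with h0 | h0
  · subst h0
    simp only [sqrtTrunc, add_zero, sub_self, mul_zero, intervalIntegral.integral_zero,
      Real.sqrt_zero, mul_one]
    exact ⟨le_rfl, by positivity⟩
  · have hsx : 0 < √x := Real.sqrt_pos.mpr h0
    have hsT : 0 < √T := Real.sqrt_pos.mpr hT
    have ex : √x ^ 2 = x := Real.sq_sqrt hx
    have h1 : Real.arctan (√T / √x) = Real.pi / 2 - Real.arctan (√x / √T) := by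
      rw [← Real.arctan_inv_of_pos (by positivity), inv_div]
    have h2 : √T⁻¹ / √x = 1 / (√T * √x) := by rw [Real.sqrt_inv]; field_simp
    have h3 : Real.pi * √x - sqrtTrunc T x =
        2 * √x * (Real.arctan (√x / √T) + Real.arctan (1 / (√T * √x))) := by
      rw [sqrtTrunc_eq hT h0, h1, h2]; ring
    have p1 : 0 ≤ Real.arctan (√x / √T) := Real.arctan_nonneg.mpr (by positivity)
    have p2 : 0 ≤ Real.arctan (1 / (√T * √x)) := Real.arctan_nonneg.mpr (by positivity)
    rw [h3]
    refine ⟨by positivity, ?_⟩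
    have q1 := arctan_le_self (x := √x / √T) (by positivity)
    have q2 := arctan_le_self (x := 1 / (√T * √x)) (by positivity)
    calc _ ≤ 2 * √x * (√x / √T + 1 / (√T * √x)) := by gcongr
      _ = 2 / √T * (1 + √x ^ 2) := by field_simp; ring
      _ = _ := by rw [ex]

variable {H : Type*} [NormedAddCommGroup H] [InnerProductSpace ℂ H] [FiniteDimensional ℂ H]

lemma continuousOn_sqrt_resolv {T : Module.End ℂ H} (hT : T.IsPositive) (u : H) :
    ContinuousOn (fun t : ℝ => ((√t : ℝ) : ℂ) • (((1 / t : ℝ) : ℂ) • u - resolv T u t))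
      (Set.Ioi 0) := by
  have h1 := continuousOn_resolv hT u
  have h2 : ContinuousOn (fun t : ℝ => 1 / t) (Set.Ioi 0) :=
    ContinuousOn.div continuousOn_const continuousOn_id fun t ht => (Set.mem_Ioi.mp ht).ne'
  have h3 : ContinuousOn (fun t : ℝ => ((1 / t : ℝ) : ℂ)) (Set.Ioi 0) :=
    Complex.continuous_ofReal.comp_continuousOn h2
  have h4 : Continuous (fun t : ℝ => ((√t : ℝ) : ℂ)) := by fun_prop
  exact h4.continuousOn.smul ((h3.smul continuousOn_const).sub h1)

lemma specMap_sqrtTrunc {S : Module.End ℂ H} (hS : S.IsPositive) (u : H) {T : ℝ} (hT : 0 < T) :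
    specMap S (sqrtTrunc T) u =
      ∫ t in T⁻¹..T, ((√t : ℝ) : ℂ) • (((1 / t : ℝ) : ℂ) • u - resolv S u t) := by
  have e : ∀ t : ℝ, ((√t : ℝ) : ℂ) • (((1 / t : ℝ) : ℂ) • u - resolv S u t) =
      ∑ z ∈ eigs S, ((√t * (1 / t - 1 / (t + z.re)) : ℝ) : ℂ) • specProj S z u := fun t => by
    have h1 : u = specMap S (fun _ => 1) u := (specMap_one hS.1 u).symm
    have h2 : ((√t : ℝ) : ℂ) • (((1 / t : ℝ) : ℂ) • u - resolv S u t) =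
        specMap S (fun x => √t * (1 / t * 1 - 1 / (t + x))) u := by
      rw [specMap_const_mul, specMap_sub, specMap_const_mul, ← h1, resolv]
    rw [h2]; simp [specMap]
  simp only [e]
  rw [intervalIntegral.integral_finsetSum]
  · refine Finset.sum_congr rfl fun z hz => ?_
    rw [intervalIntegral.integral_smul_const, intervalIntegral.integral_ofReal]
    rfl
  · intro z hz
    refine ContinuousOn.intervalIntegrable ?_
    refine ContinuousOn.smul ?_ continuousOn_const
    exact Complex.continuous_ofReal.comp_continuousOn
      ((continuousOn_sqrt_kernel (re_nonneg_of_mem_eigs hS hz)).mono (uIcc_subset_Ioi hT))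

/-- The tail bound is linear in x, so the error is governed by ‖S u‖ and not by the operator norm of
S. -/
lemma norm_specMap_sqrt_sub_le {S : Module.End ℂ H} (hS : S.IsPositive) (u : H) {T : ℝ}
    (hT : 0 < T) :
    ‖specMap S (fun x => Real.pi * √x - sqrtTrunc T x) u‖ ≤ 2 / √T * (‖u‖ + ‖S u‖) := by
  refine (norm_specMap_le hS (fun x hx => (sqrtTrunc_bounds hT hx).1)
    (fun x hx => (sqrtTrunc_bounds hT hx).2) u).trans ?_
  rw [specMap_const_mul, specMap_add, specMap_one hS.1, specMap_id hS.1, norm_smul,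
    Complex.norm_of_nonneg (by positivity)]
  gcongr
  exact norm_add_le _ _

variable {T₁ T₂ : Module.End ℂ H} {u₁ u₂ : H} {V : H →ₗ[ℂ] H}

/-- The 1/t terms cancel because V u₂ = u₁, and `Dominates.gap_ge` controls what is left. The
inequality w ≤ η/2 + w²/(2η) plays the role of Cauchy–Schwarz and keeps the bound linear in the
resolvent gap. -/
lemma Dominates.norm_middle_le (hD : Dominates T₁ T₂ u₁ u₂ V) (hV : V u₂ = u₁) {T η : ℝ}
    (hT : 1 ≤ T) (hη : 0 < η) :
    ‖V (specMap T₂ (sqrtTrunc T) u₂) - specMap T₁ (sqrtTrunc T) u₁‖ ≤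
      η * T / 2 + (∫ t in T⁻¹..T, (resSum T₁ u₁ t - resSum T₂ u₂ t)) / (2 * η) := by
  have hT0 : 0 < T := by linarith
  have hle : T⁻¹ ≤ T := (inv_le_one_of_one_le₀ hT).trans hT
  have c1 := (continuousOn_sqrt_resolv hD.pos₁ u₁).mono (uIcc_subset_Ioi hT0)
  have c2 := (continuousOn_sqrt_resolv hD.pos₂ u₂).mono (uIcc_subset_Ioi hT0)
  have c3 : ContinuousOn (fun t : ℝ => LinearMap.toContinuousLinearMap V
      (((√t : ℝ) : ℂ) • (((1 / t : ℝ) : ℂ) • u₂ - resolv T₂ u₂ t))) (Set.uIcc T⁻¹ T) :=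
    (LinearMap.toContinuousLinearMap V).continuous.comp_continuousOn c2
  have hcV : ∀ x, V x = LinearMap.toContinuousLinearMap V x := fun _ => rfl
  rw [specMap_sqrtTrunc hD.pos₁ u₁ hT0, specMap_sqrtTrunc hD.pos₂ u₂ hT0, hcV,
    ← ContinuousLinearMap.intervalIntegral_comp_comm _ c2.intervalIntegrable,
    ← intervalIntegral.integral_sub c3.intervalIntegrable c1.intervalIntegrable]
  have cD : ContinuousOn (fun t => resSum T₁ u₁ t - resSum T₂ u₂ t) (Set.uIcc T⁻¹ T) :=
    fun t ht => ((continuousAt_resSum hD.pos₁ u₁ (uIcc_subset_Ioi hT0 ht)).sub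
      (continuousAt_resSum hD.pos₂ u₂ (uIcc_subset_Ioi hT0 ht))).continuousWithinAt
  have hb : ∀ t ∈ Set.Ioc T⁻¹ T, ‖(LinearMap.toContinuousLinearMap V)
      (((√t : ℝ) : ℂ) • (((1 / t : ℝ) : ℂ) • u₂ - resolv T₂ u₂ t)) -
      ((√t : ℝ) : ℂ) • (((1 / t : ℝ) : ℂ) • u₁ - resolv T₁ u₁ t)‖ ≤
      η / 2 + (resSum T₁ u₁ t - resSum T₂ u₂ t) / (2 * η) := by
    intro t ht
    have ht0 : 0 < t := lt_trans (inv_pos.mpr hT0) ht.1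
    have e : (LinearMap.toContinuousLinearMap V)
      (((√t : ℝ) : ℂ) • (((1 / t : ℝ) : ℂ) • u₂ - resolv T₂ u₂ t)) -
      ((√t : ℝ) : ℂ) • (((1 / t : ℝ) : ℂ) • u₁ - resolv T₁ u₁ t) =
      -(((√t : ℝ) : ℂ) • (V (resolv T₂ u₂ t) - resolv T₁ u₁ t)) := by
      rw [← hcV, map_smul, map_sub, map_smul, hV, ← smul_sub, ← smul_neg]
      congr 1; abel
    rw [e, norm_neg, norm_smul, Complex.norm_of_nonneg (Real.sqrt_nonneg t)]
    have hg := hD.gap_ge ht0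
    set w := ‖V (resolv T₂ u₂ t) - resolv T₁ u₁ t‖
    set g := resSum T₁ u₁ t - resSum T₂ u₂ t
    have h1 : (√t * w) ^ 2 ≤ g := by rw [mul_pow, Real.sq_sqrt ht0.le]; exact hg
    have h2 : η / 2 + g / (2 * η) = (η ^ 2 + g) / (2 * η) := by field_simp
    rw [h2, le_div_iff₀ (by positivity)]
    nlinarith [sq_nonneg (√t * w - η)]
  refine (intervalIntegral.norm_integral_le_of_norm_le hle (Eventually.of_forall fun t ht => hb t ht)
    ((continuousOn_const.add (cD.div_const _)).intervalIntegrable)).trans ?_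
  rw [intervalIntegral.integral_add intervalIntegrable_const (cD.div_const _).intervalIntegrable,
    intervalIntegral.integral_const, intervalIntegral.integral_div, smul_eq_mul]
  have : 0 < T⁻¹ := by positivity
  gcongr
  nlinarith

lemma Dominates.norm_sqrt_sub_le (hD : Dominates T₁ T₂ u₁ u₂ V) (hV : V u₂ = u₁) {T η L : ℝ}
    (hT : 1 ≤ T) (hη : 0 < η) (hu : ‖u₁‖ = 1) (h₁ : ‖T₁ u₁‖ ≤ L) (h₂ : ‖T₂ u₂‖ ≤ L) :
    ‖V (specMap T₂ Real.sqrt u₂) - specMap T₁ Real.sqrt u₁‖ ≤ 4 * (1 + L) / √T + (η * T / 2 +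
      (∫ t in T⁻¹..T, (resSum T₁ u₁ t - resSum T₂ u₂ t)) / (2 * η)) := by
  have hT0 : 0 < T := by linarith
  have hm := hD.norm_middle_le hV hT hη
  have b1 := norm_specMap_sqrt_sub_le hD.pos₁ u₁ hT0
  have b2 := (hD.norm_le _).trans (norm_specMap_sqrt_sub_le hD.pos₂ u₂ hT0)
  rw [specMap_sub, specMap_const_mul] at b1 b2
  rw [← hD.norm_eq, hu] at b2
  rw [hu] at b1
  set A₁ := specMap T₁ Real.sqrt u₁
  set A₂ := specMap T₂ Real.sqrt u₂
  set B₁ := specMap T₁ (sqrtTrunc T) u₁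
  set B₂ := specMap T₂ (sqrtTrunc T) u₂
  have e : (Real.pi : ℂ) • (V A₂ - A₁) =
      V ((Real.pi : ℂ) • A₂ - B₂) - ((Real.pi : ℂ) • A₁ - B₁) + (V B₂ - B₁) := by
    rw [map_sub, map_smul, smul_sub]; abel
  have hn : Real.pi * ‖V A₂ - A₁‖ = ‖(Real.pi : ℂ) • (V A₂ - A₁)‖ := by
    rw [norm_smul, Complex.norm_of_nonneg Real.pi_pos.le]
  -- The integral represents π√x; the gain of a factor 1/π is discarded.
  have hpi : ‖V A₂ - A₁‖ ≤ Real.pi * ‖V A₂ - A₁‖ :=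
    le_mul_of_one_le_left (norm_nonneg _) (by linarith [Real.pi_gt_three])
  have t1 := norm_add_le (V ((Real.pi : ℂ) • A₂ - B₂) - ((Real.pi : ℂ) • A₁ - B₁)) (V B₂ - B₁)
  have t2 := norm_sub_le (V ((Real.pi : ℂ) • A₂ - B₂)) ((Real.pi : ℂ) • A₁ - B₁)
  have s1 : 2 / √T * (1 + ‖T₁ u₁‖) ≤ 2 / √T * (1 + L) := by gcongr
  have s2 : 2 / √T * (1 + ‖T₂ u₂‖) ≤ 2 / √T * (1 + L) := by gcongr
  have s3 : 4 * (1 + L) / √T = 2 / √T * (1 + L) + 2 / √T * (1 + L) := by ring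
  rw [s3]
  rw [← e, ← hn] at t1
  linarith

variable {f : ℝ → ℝ} {a b : ℝ} {μ : Measure ℝ}

lemma Dominates.gap_toReal_nonneg (hD : Dominates T₁ T₂ u₁ u₂ V)
    (h : CanonicalRepresentation (fun x => -f x) a b μ) (hne : specEntropy f T₁ u₁ ≠ ⊤) :
    0 ≤ (specEntropy f T₁ u₁).toReal - (specEntropy f T₂ u₂).toReal :=
  sub_nonneg.mpr
    (EReal.toReal_le_toReal (hD.specEntropy_le h) (specEntropy_ne_bot f T₂ u₂) hne)

lemma Dominates.integral_gap_le (hD : Dominates T₁ T₂ u₁ u₂ V)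
    (h : CanonicalRepresentation (fun x => -f x) a b μ) (hne : specEntropy f T₁ u₁ ≠ ⊤)
    {T B : ℝ} (hT : 1 ≤ T) (hB : 0 ≤ B) (hμ : leastConst μ T < ENNReal.ofReal B) :
    ∫ t in T⁻¹..T, (resSum T₁ u₁ t - resSum T₂ u₂ t) ≤
      B * ((specEntropy f T₁ u₁).toReal - (specEntropy f T₂ u₂).toReal) := by
  have hT0 : 0 < T := by linarith
  have hle : T⁻¹ ≤ T := (inv_le_one_of_one_le₀ hT).trans hT
  have hgap := hD.gap_toReal_nonneg h hne
  -- The strict inequality yields an admissible constant below B without asking whether the infimum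
  -- is attained.
  obtain ⟨K, hK, hKB⟩ := sInf_lt_iff.mp hμ
  have cD : ContinuousOn (fun t => resSum T₁ u₁ t - resSum T₂ u₂ t) (Set.Icc T⁻¹ T) :=
    fun t ht => by
      have ht0 : 0 < t := lt_of_lt_of_le (inv_pos.mpr hT0) ht.1
      exact ((continuousAt_resSum hD.pos₁ u₁ ht0).sub
        (continuousAt_resSum hD.pos₂ u₂ ht0)).continuousWithinAt
  rw [intervalIntegral.integral_of_le hle, ← integral_Icc_eq_integral_Ioc]
  have hnn : 0 ≤ᵐ[volume.restrict (Set.Icc T⁻¹ T)] fun t => resSum T₁ u₁ t - resSum T₂ u₂ t := by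
    filter_upwards [ae_restrict_mem measurableSet_Icc] with t ht
    exact hD.gap_nonneg (lt_of_lt_of_le (inv_pos.mpr hT0) ht.1)
  rw [← ENNReal.ofReal_le_ofReal_iff (by positivity),
    ofReal_integral_eq_lintegral_ofReal cD.integrableOn_Icc hnn, ENNReal.ofReal_mul hB]
  calc ∫⁻ t in Set.Icc T⁻¹ T, ENNReal.ofReal (resSum T₁ u₁ t - resSum T₂ u₂ t)
      ≤ ∫⁻ t, ENNReal.ofReal (resSum T₁ u₁ t - resSum T₂ u₂ t) ∂(K • μ.restrict (Set.Icc T⁻¹ T)) :=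
        lintegral_mono' hK le_rfl
    _ = K * ∫⁻ t in Set.Icc T⁻¹ T, ENNReal.ofReal (resSum T₁ u₁ t - resSum T₂ u₂ t) ∂μ := by
        rw [lintegral_smul_measure, smul_eq_mul]
    _ ≤ _ := mul_le_mul' hKB.le
        ((setLIntegral_le_lintegral _ _).trans (hD.lintegral_gap_le h hne))

lemma Dominates.norm_sqrt_sub_le_of_gap_le (hD : Dominates T₁ T₂ u₁ u₂ V)
    (h : CanonicalRepresentation (fun x => -f x) a b μ) (hne : specEntropy f T₁ u₁ ≠ ⊤)
    (hV : V u₂ = u₁) {T L c C : ℝ} (hT : 1 ≤ T) (hC : 0 < C)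
    (hμ : leastConst μ T ≤ ENNReal.ofReal (C * T ^ (2 * c)))
    (hu : ‖u₁‖ = 1) (h₁ : ‖T₁ u₁‖ ≤ L) (h₂ : ‖T₂ u₂‖ ≤ L)
    (hgap : (specEntropy f T₁ u₁).toReal - (specEntropy f T₂ u₂).toReal ≤ T ^ (-(2 * (1 + c)))) :
    ‖V (specMap T₂ Real.sqrt u₂) - specMap T₁ Real.sqrt u₁‖ ≤
      (4 * (1 + L) + (C + 2) / 2) * T ^ (-(1 / 2) : ℝ) := by
  have hT0 : 0 < T := by linarith
  -- Replacing C by C + 1 makes the inequality strict.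
  have hlt : leastConst μ T < ENNReal.ofReal ((C + 1) * T ^ (2 * c)) := by
    refine hμ.trans_lt (ENNReal.ofReal_lt_ofReal_iff_of_nonneg (by positivity) |>.mpr ?_)
    have : 0 < T ^ (2 * c) := by positivity
    linarith
  have hG := hD.integral_gap_le h hne hT (by positivity) hlt
  -- The assumption on the entropy gap makes G of order T⁻², so η = T^{-3/2} balances ηT and G/η,
  -- both of order T^{-1/2}.
  have hη : 0 < T ^ (-(3 / 2) : ℝ) := by positivity
  have hm := hD.norm_sqrt_sub_le hV hT hη hu h₁ h₂
  set G := ∫ t in T⁻¹..T, (resSum T₁ u₁ t - resSum T₂ u₂ t)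
  set δ := (specEntropy f T₁ u₁).toReal - (specEntropy f T₂ u₂).toReal
  have e1 : T ^ (-(3 / 2) : ℝ) * T = T ^ (-(1 / 2) : ℝ) := by
    rw [← Real.rpow_add_one hT0.ne']; norm_num
  have e2 : 1 / √T = T ^ (-(1 / 2) : ℝ) := by
    rw [Real.sqrt_eq_rpow, Real.rpow_neg hT0.le, one_div]
  have e3 : T ^ (2 * c) * T ^ (-(2 * (1 + c))) = T ^ (-(3 / 2) : ℝ) * T ^ (-(1 / 2) : ℝ) := by
    rw [← Real.rpow_add hT0, ← Real.rpow_add hT0]; congr 1; ring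
  have hG2 : G ≤ (C + 1) * (T ^ (-(3 / 2) : ℝ) * T ^ (-(1 / 2) : ℝ)) := by
    rw [← e3, ← mul_assoc]
    exact hG.trans (mul_le_mul_of_nonneg_left hgap (by positivity))
  have hG3 : G / (2 * T ^ (-(3 / 2) : ℝ)) ≤ (C + 1) / 2 * T ^ (-(1 / 2) : ℝ) := by
    rw [div_le_iff₀ (by positivity)]; linarith
  have e4 : 4 * (1 + L) / √T = 4 * (1 + L) * T ^ (-(1 / 2) : ℝ) := by rw [← e2]; ring
  rw [e4, e1] at hm
  linarith

/-- Quantitative stability of the data processing inequality. -/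
theorem Dominates.stability (hD : Dominates T₁ T₂ u₁ u₂ V)
    (h : CanonicalRepresentation (fun x => -f x) a b μ) (hne : specEntropy f T₁ u₁ ≠ ⊤)
    (hV : V u₂ = u₁) {L c C : ℝ} (hc : 0 < c) (hC : 0 < C)
    (hμ : ∀ T : ℝ, 0 < T → leastConst μ T ≤ ENNReal.ofReal (C * T ^ (2 * c)))
    (hu : ‖u₁‖ = 1) (h₁ : ‖T₁ u₁‖ ≤ L) (h₂ : ‖T₂ u₂‖ ≤ L)
    (hs₁ : ‖specMap T₁ Real.sqrt u₁‖ ≤ 1) (hs₂ : ‖specMap T₂ Real.sqrt u₂‖ ≤ 1) :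
    ‖V (specMap T₂ Real.sqrt u₂) - specMap T₁ Real.sqrt u₁‖ ≤ (4 * (1 + L) + (C + 2) / 2) *
      ((specEntropy f T₁ u₁).toReal - (specEntropy f T₂ u₂).toReal) ^ (1 / (4 * (1 + c))) := by
  have hgap := hD.gap_toReal_nonneg h hne
  have key := fun T (hT : 1 ≤ T) => hD.norm_sqrt_sub_le_of_gap_le h hne hV (c := c) hT hC
    (hμ T (by linarith)) hu h₁ h₂
  set δ := (specEntropy f T₁ u₁).toReal - (specEntropy f T₂ u₂).toReal
  have hL : 0 ≤ L := (norm_nonneg _).trans h₁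
  rcases hgap.eq_or_lt with h0 | h0
  -- With zero gap every T ≥ 1 is admissible, so T tends to infinity.
  · rw [← h0, Real.zero_rpow (by positivity), mul_zero]
    have hlim : Tendsto (fun T : ℝ => (4 * (1 + L) + (C + 2) / 2) * T ^ (-(1 / 2) : ℝ)) atTop
        (𝓝 ((4 * (1 + L) + (C + 2) / 2) * 0)) :=
      (tendsto_rpow_neg_atTop (by norm_num)).const_mul _
    rw [mul_zero] at hlim
    refine ge_of_tendsto hlim ?_
    filter_upwards [eventually_ge_atTop 1] with T hT
    exact key T hT (by rw [← h0]; positivity)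
  · rcases le_or_gt δ 1 with h1 | h1
    -- This T satisfies T^{-2(1+c)} = δ, the extreme admissible case, and T^{-1/2} = δ^{1/(4(1+c))}
    -- is the claimed rate.
    · have hT : 1 ≤ δ ^ (-(1 / (2 * (1 + c)))) :=
        Real.one_le_rpow_of_pos_of_le_one_of_nonpos h0 h1 (by rw [neg_nonpos]; positivity)
      have := key _ hT (by
        rw [← Real.rpow_mul h0.le]
        have : -(1 / (2 * (1 + c))) * -(2 * (1 + c)) = 1 := by field_simp
        rw [this, Real.rpow_one])
      rw [← Real.rpow_mul h0.le] at this
      convert! this using 3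
      field_simp
      norm_num
    -- Here the previous choice of T would be below 1, but the trivial bound 1 + 1 is already
    -- enough.
    · have h2 : 1 ≤ δ ^ (1 / (4 * (1 + c))) := Real.one_le_rpow h1.le (by positivity)
      have h3 := norm_sub_le (V (specMap T₂ Real.sqrt u₂)) (specMap T₁ Real.sqrt u₁)
      have h4 := hD.norm_le (specMap T₂ Real.sqrt u₂)
      have h5 : 2 ≤ 4 * (1 + L) + (C + 2) / 2 := by linarith
      nlinarith

end SquareRoot

end SquareRootEstimate

/-! ### Matrix functional calculus, traces and the conditional expectation. -/

section MatrixCalculus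

open Matrix

variable {n : ℕ} {A B X Y : Matrix (Fin n) (Fin n) ℂ}

section FunctionalCalculus

/-- The spectrum is finite, so discontinuous functions such as x⁻¹, the sign and the indicator of x
≠ 0 are legitimate in `cfc`. -/
lemma continuousOn_spectrum (g : ℝ → ℝ) : ContinuousOn g (spectrum ℝ A) :=
  A.finite_real_spectrum.continuousOn g

lemma spectrum_nonneg (hA : A.PosSemidef) {x : ℝ} (hx : x ∈ spectrum ℝ A) : 0 ≤ x := by
  rw [hA.1.spectrum_real_eq_range_eigenvalues] at hx
  obtain ⟨i, rfl⟩ := hx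
  exact hA.eigenvalues_nonneg i

lemma cfc_mul_eq {g h k : ℝ → ℝ} (H : ∀ x ∈ spectrum ℝ A, g x * h x = k x) :
    cfc g A * cfc h A = cfc k A := by
  rw [← cfc_mul g h A (continuousOn_spectrum g) (continuousOn_spectrum h)]
  exact cfc_congr H

lemma isHermitian_cfc (g : ℝ → ℝ) (A : Matrix (Fin n) (Fin n) ℂ) : (cfc g A).IsHermitian :=
  cfc_predicate (p := IsSelfAdjoint) g A

lemma posSemidef_cfc {g : ℝ → ℝ} (hg : ∀ x ∈ spectrum ℝ A, 0 ≤ g x) : (cfc g A).PosSemidef := by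
  have h : cfc g A = (cfc (fun x => √(g x)) A)ᴴ * cfc (fun x => √(g x)) A := by
    rw [(isHermitian_cfc _ A).eq]
    exact (cfc_mul_eq fun x hx => Real.mul_self_sqrt (hg x hx)).symm
  rw [h]
  exact posSemidef_conjTranspose_mul_self _

lemma cfc_self (hA : A.IsHermitian) : cfc (fun x : ℝ => x) A = A := cfc_id' ℝ A hA

lemma posSemidef_smul_one_sub (hA : A.IsHermitian) {r : ℝ} (h : ∀ x ∈ spectrum ℝ A, x ≤ r) :
    ((r : ℂ) • (1 : Matrix (Fin n) (Fin n) ℂ) - A).PosSemidef := by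
  have e : (r : ℂ) • (1 : Matrix (Fin n) (Fin n) ℂ) - A = cfc (fun x => r - x) A := by
    rw [cfc_sub (fun _ => r) (fun x => x) A (continuousOn_spectrum _) (continuousOn_spectrum _),
      cfc_const r A hA.isSelfAdjoint, cfc_self hA, Algebra.algebraMap_eq_smul_one]
    rfl
  rw [e]
  exact posSemidef_cfc fun x hx => sub_nonneg.mpr (h x hx)

/-- The support projection. -/
def supp (A : Matrix (Fin n) (Fin n) ℂ) : Matrix (Fin n) (Fin n) ℂ :=
  cfc (fun x : ℝ => if x = 0 then 0 else 1) A

lemma invSqrtMat_eq (A : Matrix (Fin n) (Fin n) ℂ) (hA : A.IsHermitian) :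
    invSqrtMat A = cfc (fun x : ℝ => √x⁻¹) A := by
  rw [invSqrtMat, sqrtMat, genInv]
  exact (cfc_comp' Real.sqrt (fun x : ℝ => x⁻¹) A
    ((A.finite_real_spectrum.image _).continuousOn _) (continuousOn_spectrum _) hA).symm

lemma isHermitian_sqrtMat (A : Matrix (Fin n) (Fin n) ℂ) : (sqrtMat A)ᴴ = sqrtMat A :=
  isHermitian_cfc _ A

lemma isHermitian_invSqrtMat (A : Matrix (Fin n) (Fin n) ℂ) : (invSqrtMat A)ᴴ = invSqrtMat A :=
  isHermitian_cfc _ _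

lemma isHermitian_genInv (A : Matrix (Fin n) (Fin n) ℂ) : (genInv A)ᴴ = genInv A :=
  isHermitian_cfc _ A

lemma isHermitian_supp (A : Matrix (Fin n) (Fin n) ℂ) : (supp A)ᴴ = supp A :=
  isHermitian_cfc _ A

lemma posSemidef_sqrtMat (A : Matrix (Fin n) (Fin n) ℂ) : (sqrtMat A).PosSemidef :=
  posSemidef_cfc fun _ _ => Real.sqrt_nonneg _

lemma posSemidef_genInv (hA : A.PosSemidef) : (genInv A).PosSemidef :=
  posSemidef_cfc fun _ hx => inv_nonneg.mpr (spectrum_nonneg hA hx)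

lemma sqrtMat_mul_self (hA : A.PosSemidef) : sqrtMat A * sqrtMat A = A := by
  conv_rhs => rw [← cfc_self hA.1]
  exact cfc_mul_eq fun x hx => Real.mul_self_sqrt (spectrum_nonneg hA hx)

lemma invSqrtMat_mul_self (hA : A.PosSemidef) : invSqrtMat A * invSqrtMat A = genInv A :=
  sqrtMat_mul_self (posSemidef_genInv hA)

lemma sqrt_mul_sqrt_inv {x : ℝ} (hx : 0 ≤ x) : √x * √x⁻¹ = if x = 0 then 0 else 1 := by
  rw [← Real.sqrt_mul hx]
  split_ifs with h <;> simp [h]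

lemma sqrtMat_mul_invSqrtMat (hA : A.PosSemidef) : sqrtMat A * invSqrtMat A = supp A := by
  rw [invSqrtMat_eq A hA.1]
  exact cfc_mul_eq fun x hx => sqrt_mul_sqrt_inv (spectrum_nonneg hA hx)

lemma invSqrtMat_mul_sqrtMat (hA : A.PosSemidef) : invSqrtMat A * sqrtMat A = supp A := by
  rw [invSqrtMat_eq A hA.1]
  exact cfc_mul_eq fun x hx => by rw [mul_comm, sqrt_mul_sqrt_inv (spectrum_nonneg hA hx)]

lemma supp_mul_self (A : Matrix (Fin n) (Fin n) ℂ) : supp A * supp A = supp A :=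
  cfc_mul_eq fun x _ => by split_ifs <;> simp

lemma supp_mul_sqrtMat (A : Matrix (Fin n) (Fin n) ℂ) : supp A * sqrtMat A = sqrtMat A :=
  cfc_mul_eq fun x _ => by split_ifs with h <;> simp [h]

lemma sqrtMat_mul_supp (A : Matrix (Fin n) (Fin n) ℂ) : sqrtMat A * supp A = sqrtMat A :=
  cfc_mul_eq fun x _ => by split_ifs with h <;> simp [h]

lemma supp_mul_invSqrtMat (hA : A.IsHermitian) : supp A * invSqrtMat A = invSqrtMat A := by
  rw [invSqrtMat_eq A hA]
  exact cfc_mul_eq fun x _ => by split_ifs with h <;> simp [h]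

lemma mul_supp (hA : A.PosSemidef) : A * supp A = A := by
  conv_lhs => lhs; rw [← sqrtMat_mul_self hA]
  rw [mul_assoc, sqrtMat_mul_supp, sqrtMat_mul_self hA]

lemma supp_mul (hA : A.PosSemidef) : supp A * A = A := by
  conv_lhs => rhs; rw [← sqrtMat_mul_self hA]
  rw [← mul_assoc, supp_mul_sqrtMat, sqrtMat_mul_self hA]

lemma mul_genInv (hA : A.PosSemidef) : A * genInv A = supp A := by
  conv_lhs => lhs; rw [← sqrtMat_mul_self hA]
  rw [← invSqrtMat_mul_self hA, mul_assoc, ← mul_assoc (sqrtMat A) (invSqrtMat A),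
    sqrtMat_mul_invSqrtMat hA, supp_mul_invSqrtMat hA.1, sqrtMat_mul_invSqrtMat hA]

lemma genInv_mul (hA : A.PosSemidef) : genInv A * A = supp A := by
  have := congrArg conjTranspose (mul_genInv hA)
  rwa [conjTranspose_mul, isHermitian_genInv, hA.1.eq, isHermitian_supp] at this

lemma invSqrtMat_mul_mul_invSqrtMat (hA : A.PosSemidef) :
    invSqrtMat A * A * invSqrtMat A = supp A := by
  conv_lhs => lhs; rhs; rw [← sqrtMat_mul_self hA]
  rw [← mul_assoc, mul_assoc, invSqrtMat_mul_sqrtMat hA, sqrtMat_mul_invSqrtMat hA, supp_mul_self]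

lemma posSemidef_one_sub_supp (hA : A.IsHermitian) : (1 - supp A).PosSemidef := by
  have : 1 - supp A = cfc (fun x : ℝ => 1 - if x = 0 then 0 else 1) A := by
    rw [cfc_sub (fun _ => (1 : ℝ)) _ A (continuousOn_spectrum _) (continuousOn_spectrum _),
      cfc_const_one ℝ A hA.isSelfAdjoint, supp]
  rw [this]
  exact posSemidef_cfc fun x _ => by split_ifs <;> norm_num

lemma cfc_mem_subalgebra {N : StarSubalgebra ℂ (Matrix (Fin n) (Fin n) ℂ)} (g : ℝ → ℝ)
    (hA : A ∈ N) : cfc g A ∈ N :=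
  have : IsClosed (N : Set (Matrix (Fin n) (Fin n) ℂ)) :=
    Submodule.closed_of_finiteDimensional N.toSubalgebra.toSubmodule
  cfc_mem (𝕜' := ℂ) (hs := this) g hA

end FunctionalCalculus

section Trace

lemma trace_re_nonneg (hA : A.PosSemidef) : 0 ≤ A.trace.re := (Complex.le_def.mp hA.trace_nonneg).1

lemma trace_conj_re_nonneg (hA : A.PosSemidef) (X : Matrix (Fin n) (Fin n) ℂ) :
    0 ≤ (Xᴴ * A * X).trace.re := trace_re_nonneg (hA.conjTranspose_mul_mul_same X)

lemma trace_mul_re_nonneg (hA : A.PosSemidef) (hB : B.PosSemidef) : 0 ≤ (A * B).trace.re := by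
  have h := trace_conj_re_nonneg hA (sqrtMat B)
  rwa [isHermitian_sqrtMat, trace_mul_comm, ← mul_assoc, sqrtMat_mul_self hB,
    trace_mul_comm] at h

lemma inner_toHS (X Y : Matrix (Fin n) (Fin n) ℂ) :
    inner ℂ (toHS n X) (toHS n Y) = (Xᴴ * Y).trace := by
  have h : ∀ (Z : Matrix (Fin n) (Fin n) ℂ) (i j : Fin n), (toHS n Z).ofLp (i, j) = Z i j :=
    fun _ _ _ => rfl
  simp only [PiLp.inner_apply, trace, diag, mul_apply, conjTranspose_apply]
  rw [Fintype.sum_prod_type_right]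
  simp [mul_comm, h]

lemma norm_sq_toHS (X : Matrix (Fin n) (Fin n) ℂ) : ‖toHS n X‖ ^ 2 = (Xᴴ * X).trace.re := by
  rw [← inner_toHS, inner_self_eq_norm_sq_to_K]
  norm_cast

lemma norm_toHS_conjTranspose (X : Matrix (Fin n) (Fin n) ℂ) : ‖toHS n Xᴴ‖ = ‖toHS n X‖ := by
  rw [← sq_eq_sq₀ (norm_nonneg _) (norm_nonneg _), norm_sq_toHS, norm_sq_toHS,
    conjTranspose_conjTranspose, trace_mul_comm]

lemma abs_trace_re_le (X Y : Matrix (Fin n) (Fin n) ℂ) :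
    |(X * Y).trace.re| ≤ ‖toHS n X‖ * ‖toHS n Y‖ := by
  have h := norm_inner_le_norm (𝕜 := ℂ) (toHS n Xᴴ) (toHS n Y)
  rw [inner_toHS, conjTranspose_conjTranspose, norm_toHS_conjTranspose] at h
  exact (Complex.abs_re_le_norm _).trans h

lemma norm_toHS_mul_le (h : (1 - Aᴴ * A).PosSemidef) (X : Matrix (Fin n) (Fin n) ℂ) :
    ‖toHS n (A * X)‖ ≤ ‖toHS n X‖ := by
  refine le_of_sq_le_sq ?_ (norm_nonneg _)
  rw [norm_sq_toHS, norm_sq_toHS, ← sub_nonneg]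
  have := trace_conj_re_nonneg h X
  rw [mul_sub, sub_mul, mul_one, trace_sub, Complex.sub_re] at this
  rwa [conjTranspose_mul, ← mul_assoc, mul_assoc Xᴴ]

end Trace

section ConditionalExpectation

variable (N : StarSubalgebra ℂ (Matrix (Fin n) (Fin n) ℂ))

/-- The conditional expectation as a linear map. -/
def condExpL : Matrix (Fin n) (Fin n) ℂ →ₗ[ℂ] Matrix (Fin n) (Fin n) ℂ :=
  (toHS n).symm.toLinearMap ∘ₗ
    (N.toSubalgebra.toSubmodule.map (toHS n).toLinearMap).starProjection.toLinearMap ∘ₗ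
    (toHS n).toLinearMap

lemma condExpL_apply (X : Matrix (Fin n) (Fin n) ℂ) : condExpL N X = hsCondExp N X := rfl

lemma hsCondExp_add (X Y : Matrix (Fin n) (Fin n) ℂ) :
    hsCondExp N (X + Y) = hsCondExp N X + hsCondExp N Y := map_add (condExpL N) X Y

lemma hsCondExp_sub (X Y : Matrix (Fin n) (Fin n) ℂ) :
    hsCondExp N (X - Y) = hsCondExp N X - hsCondExp N Y := map_sub (condExpL N) X Y

lemma hsCondExp_smul (r : ℂ) (X : Matrix (Fin n) (Fin n) ℂ) :
    hsCondExp N (r • X) = r • hsCondExp N X := map_smul (condExpL N) r X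

lemma hsCondExp_mem (X : Matrix (Fin n) (Fin n) ℂ) : hsCondExp N X ∈ N := by
  have h := Submodule.starProjection_apply_mem
    (N.toSubalgebra.toSubmodule.map (toHS n).toLinearMap) (toHS n X)
  obtain ⟨Y, hY, h2⟩ := h
  have : hsCondExp N X = Y := by
    rw [hsCondExp, ← h2]; simp
  rw [this]; exact hY

variable {N}

lemma trace_mul_hsCondExp (hY : Y ∈ N) (X : Matrix (Fin n) (Fin n) ℂ) :
    (Y * hsCondExp N X).trace = (Y * X).trace := by
  have h := Submodule.starProjection_inner_eq_zero
    (K := N.toSubalgebra.toSubmodule.map (toHS n).toLinearMap) (toHS n X) (toHS n Yᴴ)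
    ⟨Yᴴ, star_mem (s := N) hY, rfl⟩
  have e : (N.toSubalgebra.toSubmodule.map (toHS n).toLinearMap).starProjection (toHS n X) =
      toHS n (hsCondExp N X) := by simp [hsCondExp]
  rw [e, ← map_sub, inner_toHS, ← conjTranspose_mul, trace_conjTranspose, star_eq_zero, mul_sub,
    trace_sub, sub_eq_zero] at h
  exact h.symm

/-- Testing against the adjoint of the difference makes its Hilbert–Schmidt norm vanish. This trace
characterization yields the bimodule property and compatibility with adjoints. -/
lemma hsCondExp_eq_of_mem {Z : Matrix (Fin n) (Fin n) ℂ} (hZ : Z ∈ N)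
    (h : ∀ Y ∈ N, (Y * Z).trace = (Y * X).trace) : hsCondExp N X = Z := by
  have hW : hsCondExp N X - Z ∈ N := sub_mem (hsCondExp_mem N X) hZ
  rw [← sub_eq_zero, ← trace_conjTranspose_mul_self_eq_zero_iff, ← star_eq_conjTranspose, mul_sub,
    trace_sub, trace_mul_hsCondExp (star_mem hW), h _ (star_mem hW), sub_self]

lemma hsCondExp_of_mem (hX : X ∈ N) : hsCondExp N X = X := hsCondExp_eq_of_mem hX fun _ _ => rfl

lemma hsCondExp_mul_left (hA : A ∈ N) (X : Matrix (Fin n) (Fin n) ℂ) :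
    hsCondExp N (A * X) = A * hsCondExp N X :=
  hsCondExp_eq_of_mem (mul_mem hA (hsCondExp_mem N X)) fun Y hY => by
    rw [← mul_assoc, trace_mul_hsCondExp (mul_mem hY hA), mul_assoc]

lemma hsCondExp_mul_right (hA : A ∈ N) (X : Matrix (Fin n) (Fin n) ℂ) :
    hsCondExp N (X * A) = hsCondExp N X * A :=
  hsCondExp_eq_of_mem (mul_mem (hsCondExp_mem N X) hA) fun Y hY => by
    rw [← mul_assoc, trace_mul_comm, ← mul_assoc, trace_mul_hsCondExp (mul_mem hA hY),
      mul_assoc, trace_mul_comm, mul_assoc]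

lemma hsCondExp_conjTranspose (X : Matrix (Fin n) (Fin n) ℂ) :
    hsCondExp N Xᴴ = (hsCondExp N X)ᴴ :=
  hsCondExp_eq_of_mem (star_mem (hsCondExp_mem N X)) fun Y hY => by
    have h := congrArg star (trace_mul_hsCondExp (star_mem hY) X)
    rw [← trace_conjTranspose, ← trace_conjTranspose, conjTranspose_mul, conjTranspose_mul,
      star_eq_conjTranspose, conjTranspose_conjTranspose, trace_mul_comm, trace_mul_comm _ Y] at h
    exact h

lemma trace_hsCondExp (X : Matrix (Fin n) (Fin n) ℂ) : (hsCondExp N X).trace = X.trace := by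
  simpa using trace_mul_hsCondExp (one_mem N) X

lemma trace_hsCondExp_mul (X Y : Matrix (Fin n) (Fin n) ℂ) :
    (hsCondExp N X * Y).trace = (X * hsCondExp N Y).trace := by
  rw [← trace_mul_hsCondExp (hsCondExp_mem N X), trace_mul_comm,
    trace_mul_hsCondExp (hsCondExp_mem N Y), trace_mul_comm]

/-- The negative part Y of E_N(X) lies in N, so 0 ≤ Tr(YX) = Tr(Y E_N(X)) = −‖Y‖², and Y = 0. -/
lemma posSemidef_hsCondExp (hX : X.PosSemidef) : (hsCondExp N X).PosSemidef := by
  set E := hsCondExp N X with hE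
  have hEH : E.IsHermitian := by
    rw [IsHermitian, hE, ← hsCondExp_conjTranspose, hX.1.eq]
  set Y := cfc (fun x : ℝ => max (-x) 0) E with hY
  have hYm : Y ∈ N := cfc_mem_subalgebra _ (hsCondExp_mem N X)
  have hYE : Y * E = -(Yᴴ * Y) := by
    have h1 : Y * E = cfc (fun x : ℝ => -(max (-x) 0 * max (-x) 0)) E := by
      conv_lhs => rhs; rw [← cfc_self hEH]
      refine cfc_mul_eq fun x _ => ?_
      rcases le_total 0 x with h | h
      · rw [max_eq_right (by linarith)]; ring
      · rw [max_eq_left (by linarith)]; ring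
    rw [h1, cfc_neg, (isHermitian_cfc _ E).eq]
    rw [cfc_mul_eq fun x _ => rfl]
  have h1 : 0 ≤ (Y * X).trace.re :=
    trace_mul_re_nonneg (posSemidef_cfc fun _ _ => le_max_right _ _) hX
  rw [← trace_mul_hsCondExp hYm, ← hE, hYE, trace_neg, Complex.neg_re, ← norm_sq_toHS] at h1
  have h2 : ‖toHS n Y‖ = 0 := by
    have := sq_nonneg ‖toHS n Y‖
    exact pow_eq_zero_iff two_ne_zero |>.mp (by linarith)
  have hY0 : Y = 0 := by simpa using h2
  have h3 : E = cfc (fun x : ℝ => max x 0) E := by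
    have h4 : cfc (fun x : ℝ => max x 0) E - Y = E := by
      rw [hY, ← cfc_sub _ _ E (continuousOn_spectrum _) (continuousOn_spectrum _)]
      conv_rhs => rw [← cfc_self hEH]
      refine cfc_congr fun x _ => ?_
      rcases le_total 0 x with h | h
      · rw [max_eq_right (by linarith : -x ≤ 0), max_eq_left h]; ring
      · rw [max_eq_left (by linarith : 0 ≤ -x), max_eq_right h]; ring
    rw [hY0, sub_zero] at h4
    exact h4.symm
  rw [h3]
  exact posSemidef_cfc fun _ _ => le_max_right _ _

end ConditionalExpectation

end MatrixCalculus

/-! ### The relative modular operator and its behaviour under channels. -/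

section RelativeModularOperator

open Matrix

variable {n : ℕ}

section RelativeModular

/-- The operator `X ↦ A X B` on the Hilbert–Schmidt space. -/
def leftRightMul (A B : Matrix (Fin n) (Fin n) ℂ) : Module.End ℂ (HS n) :=
  (toHS n).toLinearMap ∘ₗ LinearMap.mulLeft ℂ A ∘ₗ LinearMap.mulRight ℂ B ∘ₗ
    (toHS n).symm.toLinearMap

lemma leftRightMul_toHS (A B X : Matrix (Fin n) (Fin n) ℂ) :
    leftRightMul A B (toHS n X) = toHS n (A * X * B) := by
  simp [leftRightMul, mul_assoc]

lemma relModular_toHS (σ ρ X : Matrix (Fin n) (Fin n) ℂ) :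
    relModular σ ρ (toHS n X) = toHS n (σ * X * genInv ρ) := leftRightMul_toHS σ (genInv ρ) X

lemma isPositive_leftRightMul {A B : Matrix (Fin n) (Fin n) ℂ} (hA : A.PosSemidef)
    (hB : B.PosSemidef) : (leftRightMul A B).IsPositive := by
  constructor
  · intro x y
    obtain ⟨X, rfl⟩ := (toHS n).surjective x
    obtain ⟨Y, rfl⟩ := (toHS n).surjective y
    rw [leftRightMul_toHS, leftRightMul_toHS, inner_toHS, inner_toHS, conjTranspose_mul,
      conjTranspose_mul, hA.1.eq, hB.1.eq, mul_assoc, trace_mul_comm]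
    simp only [mul_assoc]
  · intro x
    obtain ⟨X, rfl⟩ := (toHS n).surjective x
    rw [inner_re_symm, leftRightMul_toHS, inner_toHS, ← mul_assoc, ← mul_assoc]
    exact trace_mul_re_nonneg (hA.conjTranspose_mul_mul_same X) hB

lemma isPositive_relModular {σ ρ : Matrix (Fin n) (Fin n) ℂ} (hσ : σ.PosSemidef)
    (hρ : ρ.PosSemidef) : (relModular σ ρ).IsPositive :=
  isPositive_leftRightMul hσ (posSemidef_genInv hρ)

lemma quasiEntropy_eq_specEntropy (f : ℝ → ℝ) (ρ σ : Matrix (Fin n) (Fin n) ℂ) :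
    quasiEntropy f ρ σ = specEntropy f (relModular σ ρ) (toHS n (sqrtMat ρ)) := rfl

variable {ρ σ : Matrix (Fin n) (Fin n) ℂ}

lemma sqrtMat_genInv_sqrtMat (hρ : ρ.PosSemidef) : sqrtMat ρ * genInv ρ * sqrtMat ρ = supp ρ := by
  rw [← invSqrtMat_mul_self hρ, ← mul_assoc, mul_assoc, sqrtMat_mul_invSqrtMat hρ,
    invSqrtMat_mul_sqrtMat hρ, supp_mul_self]

lemma sqrtMat_mul_genInv (hρ : ρ.PosSemidef) : sqrtMat ρ * genInv ρ = invSqrtMat ρ := by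
  rw [← invSqrtMat_mul_self hρ, ← mul_assoc, sqrtMat_mul_invSqrtMat hρ, supp_mul_invSqrtMat hρ.1]

lemma mul_invSqrtMat (hρ : ρ.PosSemidef) : ρ * invSqrtMat ρ = sqrtMat ρ := by
  conv_lhs => lhs; rw [← sqrtMat_mul_self hρ]
  rw [mul_assoc, sqrtMat_mul_invSqrtMat hρ, sqrtMat_mul_supp]

lemma norm_sqrtMat (hρ : ρ.PosSemidef) (h : ρ.trace = 1) : ‖toHS n (sqrtMat ρ)‖ = 1 := by
  rw [← sq_eq_sq₀ (norm_nonneg _) zero_le_one, norm_sq_toHS, isHermitian_sqrtMat,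
    sqrtMat_mul_self hρ, h]
  simp

/-- The moment is Tr(σ supp ρ), and the support inclusion removes the projection. Trace preservation
then equates the moments before and after a channel. -/
lemma specSum_id_relModular (hσ : σ.PosSemidef) (hρ : ρ.PosSemidef) (hs : σ * supp ρ = σ) :
    specSum (relModular σ ρ) (fun x => x) (toHS n (sqrtMat ρ)) = σ.trace.re := by
  have hp := isPositive_relModular hσ hρ
  have h := inner_left_specMap hp.1 (fun x => x) (toHS n (sqrtMat ρ))
  rw [specMap_id hp.1, relModular_toHS, inner_toHS, isHermitian_sqrtMat, trace_mul_comm,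
    mul_assoc, mul_assoc, ← mul_assoc (sqrtMat ρ), sqrtMat_genInv_sqrtMat hρ, hs] at h
  rw [h]; simp

/-- The positive square root of Δ is X ↦ σ^{1/2} X ρ^{-1/2}, which takes ρ^{1/2} to σ^{1/2} supp ρ =
σ^{1/2}. -/
lemma specMap_sqrt_relModular (hσ : σ.PosSemidef) (hρ : ρ.PosSemidef) (hs : σ * supp ρ = σ) :
    specMap (relModular σ ρ) Real.sqrt (toHS n (sqrtMat ρ)) = toHS n (sqrtMat σ) := by
  have hq : sqrtMat σ * supp ρ = sqrtMat σ := by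
    have h1 : ((sqrtMat σ * (1 - supp ρ))ᴴ * (sqrtMat σ * (1 - supp ρ))) = 0 := by
      rw [conjTranspose_mul, isHermitian_sqrtMat, mul_assoc, ← mul_assoc (sqrtMat σ),
        sqrtMat_mul_self hσ, mul_sub, mul_one, hs, sub_self, mul_zero]
    have h2 := conjTranspose_mul_self_eq_zero.mp h1
    rw [mul_sub, mul_one, sub_eq_zero] at h2
    exact h2.symm
  rw [specMap_sqrt (isPositive_relModular hσ hρ)
    (isPositive_leftRightMul (posSemidef_sqrtMat σ) (posSemidef_sqrtMat (genInv ρ)))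
    (fun x => ?_), leftRightMul_toHS, mul_assoc]
  · change toHS n (sqrtMat σ * (sqrtMat ρ * invSqrtMat ρ)) = _
    rw [sqrtMat_mul_invSqrtMat hρ, hq]
  · obtain ⟨X, rfl⟩ := (toHS n).surjective x
    rw [leftRightMul_toHS, leftRightMul_toHS, relModular_toHS]
    change toHS n (sqrtMat σ * (sqrtMat σ * X * invSqrtMat ρ) * invSqrtMat ρ) = _
    rw [← invSqrtMat_mul_self hρ]
    conv_rhs => rw [← sqrtMat_mul_self hσ]
    simp only [mul_assoc]

/-- If `σ ≤ κ ρ` then `‖Δ_{σ,ρ} ρ^{1/2}‖² = Tr(σ ρ⁺ σ) ≤ κ`. -/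
lemma norm_relModular_le (hρ : ρ.PosSemidef) (hσ : σ.PosSemidef) (htr : σ.trace = 1)
    {κ : ℝ} (hκ : 0 < κ) (h : ((κ : ℂ) • ρ - σ).PosSemidef) :
    ‖relModular σ ρ (toHS n (sqrtMat ρ))‖ ≤ √κ := by
  refine Real.le_sqrt_of_sq_le ?_
  rw [relModular_toHS, mul_assoc, sqrtMat_mul_genInv hρ, norm_sq_toHS, conjTranspose_mul,
    isHermitian_invSqrtMat, hσ.1.eq, mul_assoc, trace_mul_comm, mul_assoc, mul_assoc,
    invSqrtMat_mul_self hρ, ← mul_assoc]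
  set Q := (σ * σ * genInv ρ).trace.re with hQ
  set G := genInv ρ with hG
  have hGH : Gᴴ = G := isHermitian_genInv ρ
  -- The first inequality gives Tr(σGσGσ) ≤ κQ, the second Tr(σGσGσ) ≥ 2κQ − κ². Together they give
  -- Q ≤ κ.
  have h1 := trace_conj_re_nonneg h (G * σ)
  have h2 := trace_conj_re_nonneg hσ (G * σ - (κ : ℂ) • 1)
  have e1 : (σ * G * ρ * (G * σ)).trace.re = Q := by
    have : G * ρ * G = G := by
      rw [hG, genInv_mul hρ, ← invSqrtMat_mul_self hρ, ← mul_assoc, supp_mul_invSqrtMat hρ.1]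
    rw [show σ * G * ρ * (G * σ) = σ * (G * ρ * G) * σ by simp only [mul_assoc], this,
      trace_mul_comm, ← mul_assoc]
  have e2 : (σ * (G * σ)).trace.re = Q := by rw [← mul_assoc, trace_mul_comm, ← mul_assoc]
  have e3 : (σ * G * σ).trace.re = Q := by rw [mul_assoc]; exact e2
  simp only [conjTranspose_mul, hGH, hσ.1.eq, mul_sub, sub_mul, trace_sub, Complex.sub_re,
    conjTranspose_sub, conjTranspose_smul, conjTranspose_one, Matrix.mul_smul, Matrix.smul_mul,
    trace_smul, smul_eq_mul, mul_one, one_mul, RCLike.star_def, Complex.conj_ofReal,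
    Complex.re_ofReal_mul, htr, Complex.ofReal_re, e1, e2, e3] at h1 h2
  nlinarith

end RelativeModular

section Channel

variable {N : StarSubalgebra ℂ (Matrix (Fin n) (Fin n) ℂ)} {K : Matrix (Fin n) (Fin n) ℂ}

lemma trace_dual_channel (X Y : Matrix (Fin n) (Fin n) ℂ) :
    (hsCondExp N (Kᴴ * Y * K) * X).trace = (Y * (K * hsCondExp N X * Kᴴ)).trace := by
  rw [trace_hsCondExp_mul, mul_assoc, mul_assoc, trace_mul_comm]
  simp only [mul_assoc]

lemma dual_channel_conjTranspose (Y : Matrix (Fin n) (Fin n) ℂ) :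
    hsCondExp N (Kᴴ * Yᴴ * K) = (hsCondExp N (Kᴴ * Y * K))ᴴ := by
  rw [← hsCondExp_conjTranspose]
  simp only [conjTranspose_mul, conjTranspose_conjTranspose, mul_assoc]

/-- The Kadison–Schwarz inequality. -/
lemma schwarz_dual_channel (hK : (1 - hsCondExp N (Kᴴ * K)).PosSemidef)
    (A : Matrix (Fin n) (Fin n) ℂ) :
    (hsCondExp N (Kᴴ * (Aᴴ * A) * K) -
      (hsCondExp N (Kᴴ * A * K))ᴴ * hsCondExp N (Kᴴ * A * K)).PosSemidef := by
  set c := hsCondExp N (Kᴴ * A * K) with hc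
  have hcm : c ∈ N := hsCondExp_mem N _
  have hcm' : cᴴ ∈ N := star_mem hcm
  -- Expanding this square gives E_N(K*A*AK) − 2c*c + c*E_N(K*K)c, and E_N(K*K) ≤ 1 replaces the
  -- last term by c*c.
  have h1 := posSemidef_hsCondExp (N := N)
    (posSemidef_conjTranspose_mul_self (A * K - K * c))
  have h2 := hK.conjTranspose_mul_mul_same c
  have e : hsCondExp N ((A * K - K * c)ᴴ * (A * K - K * c)) =
      hsCondExp N (Kᴴ * (Aᴴ * A) * K) - cᴴ * c - cᴴ * c + cᴴ * hsCondExp N (Kᴴ * K) * c := by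
    have e1 : (A * K - K * c)ᴴ * (A * K - K * c) = Kᴴ * (Aᴴ * A) * K - (Kᴴ * Aᴴ * K) * c -
        cᴴ * (Kᴴ * A * K) + cᴴ * (Kᴴ * K) * c := by
      simp only [conjTranspose_sub, conjTranspose_mul, mul_sub, sub_mul, mul_assoc]
      abel
    rw [e1, hsCondExp_add, hsCondExp_sub, hsCondExp_sub, hsCondExp_mul_right hcm,
      hsCondExp_mul_left hcm', hsCondExp_mul_right hcm, hsCondExp_mul_left hcm',
      dual_channel_conjTranspose, ← hc]
  have := h1.add h2
  rw [e] at this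
  convert! this using 1
  rw [mul_sub, mul_one, sub_mul]
  abel

variable (N K) in
/-- The contraction `X ↦ Ψ(X ρ₂^{-1/2}) ρ₁^{1/2}` attached to the dual channel
`Ψ(Y) = E_N(K* Y K)`. -/
def petzContraction (ρ₁ ρ₂ : Matrix (Fin n) (Fin n) ℂ) : Module.End ℂ (HS n) :=
  (toHS n).toLinearMap ∘ₗ LinearMap.mulRight ℂ (sqrtMat ρ₁) ∘ₗ condExpL N ∘ₗ
    LinearMap.mulRight ℂ K ∘ₗ LinearMap.mulLeft ℂ Kᴴ ∘ₗ LinearMap.mulRight ℂ (invSqrtMat ρ₂) ∘ₗ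
    (toHS n).symm.toLinearMap

lemma petzContraction_toHS (ρ₁ ρ₂ X : Matrix (Fin n) (Fin n) ℂ) :
    petzContraction N K ρ₁ ρ₂ (toHS n X) =
      toHS n (hsCondExp N (Kᴴ * (X * invSqrtMat ρ₂) * K) * sqrtMat ρ₁) := by
  simp [petzContraction, condExpL_apply]

variable {ρ₁ σ₁ ρ₂ σ₂ : Matrix (Fin n) (Fin n) ℂ}

/-- The channel `X ↦ K E_N(X) K*` decreases quasi-entropies. -/
lemma dominates_of_channel (hK : (1 - hsCondExp N (Kᴴ * K)).PosSemidef)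
    (hρ₁ : ρ₁.PosSemidef) (hσ₁ : σ₁.PosSemidef) (hρ₂ : ρ₂.PosSemidef) (hσ₂ : σ₂.PosSemidef)
    (hρ : K * hsCondExp N ρ₁ * Kᴴ = ρ₂) (hσ : K * hsCondExp N σ₁ * Kᴴ = σ₂)
    (trρ₁ : ρ₁.trace = 1) (trρ₂ : ρ₂.trace = 1) (trσ : σ₁.trace = σ₂.trace)
    (hs₁ : σ₁ * supp ρ₁ = σ₁) (hs₂ : σ₂ * supp ρ₂ = σ₂) :
    Dominates (relModular σ₁ ρ₁) (relModular σ₂ ρ₂) (toHS n (sqrtMat ρ₁)) (toHS n (sqrtMat ρ₂))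
      (petzContraction N K ρ₁ ρ₂) where
  pos₁ := isPositive_relModular hσ₁ hρ₁
  pos₂ := isPositive_relModular hσ₂ hρ₂
  norm_le x := by
    obtain ⟨X, rfl⟩ := (toHS n).surjective x
    refine le_of_sq_le_sq ?_ (norm_nonneg _)
    rw [petzContraction_toHS, norm_sq_toHS, norm_sq_toHS]
    set B := X * invSqrtMat ρ₂ with hB
    -- Duality moves ρ₁ to ρ₂, which cancels the two factors ρ₂^{-1/2} in B*B up to the support
    -- projection.
    have h1 := trace_mul_re_nonneg (schwarz_dual_channel hK B) hρ₁
    rw [sub_mul, trace_sub, Complex.sub_re, trace_dual_channel, hρ] at h1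
    have h2 := trace_mul_re_nonneg (posSemidef_conjTranspose_mul_self X)
      (posSemidef_one_sub_supp hρ₂.1)
    have e : (Bᴴ * B * ρ₂).trace = (Xᴴ * X * supp ρ₂).trace := by
      rw [← invSqrtMat_mul_mul_invSqrtMat hρ₂, hB, conjTranspose_mul, isHermitian_invSqrtMat,
        mul_assoc, mul_assoc, trace_mul_comm]
      simp only [mul_assoc]
    rw [mul_sub, mul_one, trace_sub, Complex.sub_re, ← e] at h2
    set P := hsCondExp N (Kᴴ * B * K)
    have e2 : ((P * sqrtMat ρ₁)ᴴ * (P * sqrtMat ρ₁)).trace = (Pᴴ * P * ρ₁).trace := by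
      rw [conjTranspose_mul, isHermitian_sqrtMat, mul_assoc, trace_mul_comm]
      conv_rhs => rw [← sqrtMat_mul_self hρ₁]
      simp only [mul_assoc]
    rw [e2]
    linarith
  inner_eq x := by
    obtain ⟨X, rfl⟩ := (toHS n).surjective x
    rw [petzContraction_toHS, inner_toHS, inner_toHS, conjTranspose_mul, isHermitian_sqrtMat,
      ← dual_channel_conjTranspose, mul_assoc, trace_mul_comm, mul_assoc, sqrtMat_mul_self hρ₁,
      trace_dual_channel, hρ, conjTranspose_mul, isHermitian_invSqrtMat, mul_assoc, trace_mul_comm]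
    rw [mul_assoc, mul_invSqrtMat hρ₂]
  form_le x := by
    obtain ⟨X, rfl⟩ := (toHS n).surjective x
    rw [petzContraction_toHS, relModular_toHS, relModular_toHS, inner_toHS, inner_toHS]
    set B := X * invSqrtMat ρ₂ with hB
    set P := hsCondExp N (Kᴴ * B * K) with hP
    have hPP : (hsCondExp N (Kᴴ * Bᴴ * K)) = Pᴴ := dual_channel_conjTranspose B
    -- The Schwarz inequality is applied to B* here, since σ multiplies from the left and the order
    -- P P* is needed.
    have h1 := schwarz_dual_channel hK Bᴴ
    rw [hPP, conjTranspose_conjTranspose, conjTranspose_conjTranspose] at h1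
    have h2 := trace_mul_re_nonneg h1 hσ₁
    rw [sub_mul, trace_sub, Complex.sub_re, trace_dual_channel, hσ] at h2
    have h3 := trace_mul_re_nonneg (hσ₁.conjTranspose_mul_mul_same P)
      (posSemidef_one_sub_supp hρ₁.1)
    rw [mul_sub, mul_one, trace_sub, Complex.sub_re, ← sqrtMat_genInv_sqrtMat hρ₁] at h3
    have e1 : ((P * sqrtMat ρ₁)ᴴ * (σ₁ * (P * sqrtMat ρ₁) * genInv ρ₁)).trace =
        (Pᴴ * σ₁ * P * (sqrtMat ρ₁ * genInv ρ₁ * sqrtMat ρ₁)).trace := by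
      rw [conjTranspose_mul, isHermitian_sqrtMat, mul_assoc, trace_mul_comm]
      simp only [mul_assoc]
    have e2 : (P * Pᴴ * σ₁).trace = (Pᴴ * σ₁ * P).trace := by
      rw [mul_assoc, trace_mul_comm]
    have e3 : (B * Bᴴ * σ₂).trace = (Xᴴ * (σ₂ * X * genInv ρ₂)).trace := by
      rw [hB, conjTranspose_mul, isHermitian_invSqrtMat, ← invSqrtMat_mul_self hρ₂, mul_assoc,
        mul_assoc, trace_mul_comm, mul_assoc, mul_assoc, trace_mul_comm]
      simp only [mul_assoc]
      rw [trace_mul_comm]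
      simp only [mul_assoc]
    rw [e2] at h2
    rw [e1, ← e3]
    linarith
  norm_eq := by rw [norm_sqrtMat hρ₁ trρ₁, norm_sqrtMat hρ₂ trρ₂]
  moment_eq := by
    rw [specSum_id_relModular hσ₁ hρ₁ hs₁, specSum_id_relModular hσ₂ hρ₂ hs₂, trσ]

end Channel

end RelativeModularOperator

/-! ### Trace norm estimates, density matrices and the recovery map. -/

section NormEstimates

open Matrix

variable {n : ℕ} {A B X : Matrix (Fin n) (Fin n) ℂ}

section Norms

lemma trace_cfc (hA : A.IsHermitian) (g : ℝ → ℝ) :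
    (cfc g A).trace = ∑ i, ((g (hA.eigenvalues i) : ℝ) : ℂ) := by
  rw [hA.cfc_eq, IsHermitian.cfc, Unitary.conjStarAlgAut_apply, trace_mul_cycle,
    Unitary.coe_star_mul_self, one_mul, trace_diagonal]
  rfl

/-- For Hermitian X one has |X| = sign(X) X, so the trace norm becomes a trace pairing with a
contraction. -/
lemma traceNorm_eq_trace_sign (hX : X.IsHermitian) :
    traceNorm X = (cfc (fun x : ℝ => (SignType.sign x : ℝ)) X * X).trace.re := by
  have h1 : ((traceNorm X : ℝ) : ℂ) = (cfc Real.sqrt (Xᴴ * X)).trace := by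
    rw [trace_cfc (isHermitian_conjTranspose_mul_self X), traceNorm]
    push_cast; rfl
  have h2 : Xᴴ * X = cfc (fun x : ℝ => x * x) X := by
    rw [hX.eq]
    conv_lhs => rw [← cfc_self hX]
    exact cfc_mul_eq fun x _ => rfl
  have h3 : cfc Real.sqrt (Xᴴ * X) = cfc (fun x : ℝ => (SignType.sign x : ℝ)) X * X := by
    rw [h2, ← cfc_comp' Real.sqrt (fun x : ℝ => x * x) X
      ((X.finite_real_spectrum.image _).continuousOn _) (continuousOn_spectrum _)
      hX.isSelfAdjoint]
    conv_rhs => rhs; rw [← cfc_self hX]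
    exact (cfc_mul_eq fun x _ => by rw [Real.sqrt_mul_self_eq_abs, sign_mul_self]).symm
  rw [← h3, ← h1]; simp

/-- Split A*A − B*B = A*(A − B) + (A − B)*B, pair with the sign of the difference and apply
Cauchy–Schwarz. -/
lemma traceNorm_sub_le (A B : Matrix (Fin n) (Fin n) ℂ) :
    traceNorm (Aᴴ * A - Bᴴ * B) ≤ (‖toHS n A‖ + ‖toHS n B‖) * ‖toHS n (A - B)‖ := by
  have hX : (Aᴴ * A - Bᴴ * B).IsHermitian :=
    (isHermitian_conjTranspose_mul_self A).sub (isHermitian_conjTranspose_mul_self B)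
  rw [traceNorm_eq_trace_sign hX]
  set X := Aᴴ * A - Bᴴ * B with hXd
  set S := cfc (fun x : ℝ => (SignType.sign x : ℝ)) X with hS
  have hSS : (1 - Sᴴ * S).PosSemidef := by
    rw [(isHermitian_cfc _ X).eq, hS, cfc_mul_eq fun x _ => rfl]
    have : (1 : Matrix (Fin n) (Fin n) ℂ) - cfc (fun x : ℝ => (SignType.sign x : ℝ) *
        (SignType.sign x : ℝ)) X = cfc (fun x : ℝ => 1 - (SignType.sign x : ℝ) *
        (SignType.sign x : ℝ)) X := by
      rw [cfc_sub (fun _ => (1 : ℝ)) _ X (continuousOn_spectrum _) (continuousOn_spectrum _),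
        cfc_const_one ℝ X hX.isSelfAdjoint]
    rw [this]
    refine posSemidef_cfc fun x _ => ?_
    rcases lt_trichotomy x 0 with h | h | h <;> simp [h]
  have e : S * X = S * Aᴴ * (A - B) + S * (A - B)ᴴ * B := by
    rw [hXd, conjTranspose_sub]; noncomm_ring
  have h1 := (le_abs_self _).trans (abs_trace_re_le (S * Aᴴ) (A - B))
  have h2 := (le_abs_self _).trans (abs_trace_re_le (S * (A - B)ᴴ) B)
  have h3 := norm_toHS_mul_le hSS Aᴴ
  have h4 := norm_toHS_mul_le hSS (A - B)ᴴ
  rw [norm_toHS_conjTranspose] at h3 h4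
  rw [e, trace_add, Complex.add_re]
  have h5 := mul_le_mul_of_nonneg_right h3 (norm_nonneg (toHS n (A - B)))
  have h6 := mul_le_mul_of_nonneg_right h4 (norm_nonneg (toHS n B))
  linarith

lemma spectrum_le_opNorm (hA : A.IsHermitian) {x : ℝ} (hx : x ∈ spectrum ℝ A) : x ≤ opNorm A := by
  rw [hA.spectrum_real_eq_range_eigenvalues] at hx
  obtain ⟨i, rfl⟩ := hx
  set v := hA.eigenvectorBasis i with hv
  have hv1 : ‖v‖ = 1 := hA.eigenvectorBasis.orthonormal.1 i
  have h1 : toEuclideanCLM (𝕜 := ℂ) A v = ((hA.eigenvalues i : ℝ) : ℂ) • v := by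
    ext j
    have := congrFun (hA.mulVec_eigenvectorBasis i) j
    simpa using this
  have h2 := (toEuclideanCLM (𝕜 := ℂ) A).le_opNorm v
  rw [h1, norm_smul, hv1, mul_one, mul_one, Complex.norm_real] at h2
  exact (le_abs_self _).trans h2

lemma norm_toHS_invSqrtMat_mul_le (hA : A.PosSemidef) (hu : IsUnit A)
    (X : Matrix (Fin n) (Fin n) ℂ) :
    ‖toHS n (invSqrtMat A * X)‖ ≤ √(opNorm A⁻¹) * ‖toHS n X‖ := by
  have hg : genInv A = A⁻¹ := by
    have h0 : supp A = 1 := by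
      have := mul_supp hA
      exact hu.mul_left_cancel (by rw [this, mul_one])
    exact (inv_eq_right_inv (by rw [mul_genInv hA, h0])).symm
  have hgp := posSemidef_genInv hA
  have h1 := trace_conj_re_nonneg
    (posSemidef_smul_one_sub hgp.1 (fun x hx => spectrum_le_opNorm hgp.1 hx)) X
  have h0 : 0 ≤ opNorm (genInv A) := norm_nonneg _
  refine le_of_sq_le_sq ?_ (by positivity)
  rw [← hg, mul_pow, Real.sq_sqrt h0, norm_sq_toHS, norm_sq_toHS, conjTranspose_mul,
    isHermitian_invSqrtMat, mul_assoc, ← mul_assoc (invSqrtMat A), invSqrtMat_mul_self hA,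
    ← mul_assoc]
  simp only [mul_sub, sub_mul, Matrix.mul_smul, Matrix.smul_mul, mul_one, trace_sub, trace_smul,
    smul_eq_mul, Complex.sub_re, Complex.re_ofReal_mul] at h1
  linarith

end Norms

section Density

variable {ρ σ : Matrix (Fin n) (Fin n) ℂ}

lemma posSemidef_one_sub_of_trace_eq_one (hσ : σ.PosSemidef) (h : σ.trace = 1) :
    (1 - σ).PosSemidef := by
  have := posSemidef_smul_one_sub hσ.1 (r := 1) fun x hx => by
    rw [hσ.1.spectrum_real_eq_range_eigenvalues] at hx
    obtain ⟨i, rfl⟩ := hx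
    have h1 : ∑ j, hσ.1.eigenvalues j = 1 := by
      have := hσ.1.trace_eq_sum_eigenvalues
      rw [h] at this
      have h2 : ((1 : ℝ) : ℂ) = ((∑ j, hσ.1.eigenvalues j : ℝ) : ℂ) := by
        push_cast; exact this
      exact (Complex.ofReal_injective h2).symm
    rw [← h1]
    exact Finset.single_le_sum (fun j _ => hσ.eigenvalues_nonneg j) (Finset.mem_univ i)
  simpa using this

lemma mul_supp_of_ker_le (hρ : ρ.PosSemidef) (h : ∀ v : Fin n → ℂ, ρ *ᵥ v = 0 → σ *ᵥ v = 0) :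
    σ * supp ρ = σ := by
  have h1 : σ * (1 - supp ρ) = 0 := by
    refine Matrix.toLin'.injective (LinearMap.ext fun v => ?_)
    rw [toLin'_apply, ← mulVec_mulVec, h]
    · simp
    · rw [mulVec_mulVec, mul_sub, mul_one, mul_supp hρ, sub_self, zero_mulVec]
  rw [mul_sub, mul_one, sub_eq_zero] at h1
  exact h1.symm

lemma minNonzeroEigenvalue_pos (hρ : ρ.PosSemidef) (h : ρ ≠ 0) :
    0 < minNonzeroEigenvalue ρ ∧
      ∀ x ∈ spectrum ℝ ρ, x ≠ 0 → minNonzeroEigenvalue ρ ≤ x := by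
  set s : Set ℝ := {l : ℝ | l ∈ spectrum ℝ ρ ∧ l ≠ 0} with hs
  have hfin : s.Finite := ρ.finite_real_spectrum.subset fun _ h => h.1
  have hne : s.Nonempty := by
    by_contra hcon
    rw [Set.not_nonempty_iff_eq_empty] at hcon
    refine h (hρ.1.eigenvalues_eq_zero_iff.mp (funext fun i => ?_))
    by_contra h0
    have : hρ.1.eigenvalues i ∈ s := ⟨hρ.1.eigenvalues_mem_spectrum_real i, h0⟩
    rw [hcon] at this
    exact this
  have hmem : minNonzeroEigenvalue ρ ∈ s := hne.csInf_mem hfin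
  exact ⟨lt_of_le_of_ne (spectrum_nonneg hρ hmem.1) (Ne.symm hmem.2),
    fun x hx h0 => csInf_le hfin.bddBelow ⟨hx, h0⟩⟩

/-- The chain is σ ≤ supp ρ ≤ λ⁻¹ρ, with λ the smallest non-zero eigenvalue. This is how λ enters
the constants. -/
lemma posSemidef_inv_minNonzeroEigenvalue_smul_sub (hρ : ρ.PosSemidef) (hρ0 : ρ ≠ 0)
    (hσ : σ.PosSemidef) (h : σ.trace = 1) (hs : σ * supp ρ = σ) :
    (((minNonzeroEigenvalue ρ)⁻¹ : ℝ) • ρ - σ).PosSemidef := by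
  obtain ⟨hpos, hle⟩ := minNonzeroEigenvalue_pos hρ hρ0
  have h1 : (supp ρ - σ).PosSemidef := by
    have := (posSemidef_one_sub_of_trace_eq_one hσ h).conjTranspose_mul_mul_same (supp ρ)
    have hs' : supp ρ * σ = σ := by
      have := congrArg conjTranspose hs
      rwa [conjTranspose_mul, isHermitian_supp, hσ.1.eq] at this
    rwa [isHermitian_supp, mul_sub, sub_mul, mul_one, supp_mul_self, hs', hs] at this
  have h2 : ((minNonzeroEigenvalue ρ)⁻¹ • ρ - supp ρ).PosSemidef := by
    have : (minNonzeroEigenvalue ρ)⁻¹ • ρ - supp ρ = cfc (fun x : ℝ =>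
        (minNonzeroEigenvalue ρ)⁻¹ * x - if x = 0 then 0 else 1) ρ := by
      rw [cfc_sub _ _ ρ (continuousOn_spectrum _) (continuousOn_spectrum _),
        cfc_const_mul _ _ ρ (continuousOn_spectrum _), cfc_self hρ.1, supp]
    rw [this]
    refine posSemidef_cfc fun x hx => ?_
    split_ifs with h0
    · simp [h0]
    · rw [sub_nonneg, inv_mul_eq_div, one_le_div hpos]
      exact hle x hx h0
  simpa using h2.add h1

variable {N : StarSubalgebra ℂ (Matrix (Fin n) (Fin n) ℂ)}

/-- With P = supp ρ_N in N, Tr((1 − P)ρ) = Tr((1 − P)ρ_N) = 0, so (1 − P)ρ^{1/2} vanishes. -/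
lemma supp_hsCondExp_mul_sqrtMat (hρ : ρ.PosSemidef) :
    supp (hsCondExp N ρ) * sqrtMat ρ = sqrtMat ρ := by
  set P := supp (hsCondExp N ρ) with hP
  have hPm : P ∈ N := cfc_mem_subalgebra _ (hsCondExp_mem N ρ)
  have hPH : Pᴴ = P := isHermitian_supp _
  have hPP : P * P = P := supp_mul_self _
  have h1 : (sqrtMat ρ - P * sqrtMat ρ) * (sqrtMat ρ - P * sqrtMat ρ)ᴴ = (1 - P) * ρ * (1 - P) := by
    conv_rhs => rw [← sqrtMat_mul_self hρ]
    rw [conjTranspose_sub, conjTranspose_mul, isHermitian_sqrtMat, hPH]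
    noncomm_ring
  have h2 : ((sqrtMat ρ - P * sqrtMat ρ) * (sqrtMat ρ - P * sqrtMat ρ)ᴴ).trace = 0 := by
    have h3 : (1 - P) * (1 - P) = 1 - P := by
      rw [mul_sub, mul_one, sub_mul, one_mul, hPP, sub_self, sub_zero]
    rw [h1, trace_mul_comm, ← mul_assoc, h3, ← trace_mul_hsCondExp (sub_mem (one_mem N) hPm),
      sub_mul, one_mul, supp_mul (posSemidef_hsCondExp hρ), sub_self, trace_zero]
  have h3 := trace_mul_conjTranspose_self_eq_zero_iff.mp h2
  rw [sub_eq_zero] at h3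
  exact h3.symm

lemma sqrtMat_mul_supp_hsCondExp (hρ : ρ.PosSemidef) :
    sqrtMat ρ * supp (hsCondExp N ρ) = sqrtMat ρ := by
  have := congrArg conjTranspose (supp_hsCondExp_mul_sqrtMat (N := N) hρ)
  rwa [conjTranspose_mul, isHermitian_sqrtMat, isHermitian_supp] at this

/-- The matrix σ ends in a factor ρ^{1/2}, which absorbs supp ρ_N; that projection lies in N and can
be pulled out of the expectation. -/
lemma hsCondExp_mul_supp (hρ : ρ.PosSemidef) (hs : σ * supp ρ = σ) :
    hsCondExp N σ * supp (hsCondExp N ρ) = hsCondExp N σ := by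
  have hm : supp (hsCondExp N ρ) ∈ N := cfc_mem_subalgebra _ (hsCondExp_mem N ρ)
  rw [← hsCondExp_mul_right hm]
  congr 1
  rw [← hs, ← invSqrtMat_mul_sqrtMat hρ, mul_assoc, mul_assoc, sqrtMat_mul_supp_hsCondExp hρ]

variable (N) in
/-- The vector `X^{1/2} ρ_N^{-1/2} ρ^{1/2}`, a square root of `petz N ρ X`. -/
def petzRoot (ρ X : Matrix (Fin n) (Fin n) ℂ) : Matrix (Fin n) (Fin n) ℂ :=
  sqrtMat X * invSqrtMat (hsCondExp N ρ) * sqrtMat ρ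

lemma petzRoot_conjTranspose_mul_self (hX : X.PosSemidef) :
    (petzRoot N ρ X)ᴴ * petzRoot N ρ X = petz N ρ X := by
  rw [petz]
  conv_rhs => lhs; rhs; lhs; rhs; rw [← sqrtMat_mul_self hX]
  simp only [petzRoot, conjTranspose_mul, isHermitian_sqrtMat, isHermitian_invSqrtMat, mul_assoc]

lemma petz_eq_mul_mul_conjTranspose (X : Matrix (Fin n) (Fin n) ℂ) :
    petz N ρ X = (sqrtMat ρ * invSqrtMat (hsCondExp N ρ)) * X *
      (sqrtMat ρ * invSqrtMat (hsCondExp N ρ))ᴴ := by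
  simp only [petz, conjTranspose_mul, isHermitian_sqrtMat, isHermitian_invSqrtMat, mul_assoc]

lemma petz_hsCondExp_self (hρ : ρ.PosSemidef) : petz N ρ (hsCondExp N ρ) = ρ := by
  rw [petz, invSqrtMat_mul_mul_invSqrtMat (posSemidef_hsCondExp hρ),
    sqrtMat_mul_supp_hsCondExp hρ, sqrtMat_mul_self hρ]

/-- For the recovery map this supplies the subunitality E_N(K*K) ≤ 1 required by
`dominates_of_channel`. -/
lemma hsCondExp_petz_kernel (hρ : ρ.PosSemidef) :
    hsCondExp N ((sqrtMat ρ * invSqrtMat (hsCondExp N ρ))ᴴ *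
      (sqrtMat ρ * invSqrtMat (hsCondExp N ρ))) = supp (hsCondExp N ρ) := by
  have hm : invSqrtMat (hsCondExp N ρ) ∈ N :=
    cfc_mem_subalgebra _ (cfc_mem_subalgebra _ (hsCondExp_mem N ρ))
  rw [conjTranspose_mul, isHermitian_sqrtMat, isHermitian_invSqrtMat, mul_assoc,
    ← mul_assoc (sqrtMat ρ), sqrtMat_mul_self hρ, hsCondExp_mul_left hm, hsCondExp_mul_right hm,
    ← mul_assoc, invSqrtMat_mul_mul_invSqrtMat (posSemidef_hsCondExp hρ)]

lemma trace_petz_hsCondExp (hρ : ρ.PosSemidef) (X : Matrix (Fin n) (Fin n) ℂ) :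
    (petz N ρ (hsCondExp N X)).trace = (hsCondExp N X * supp (hsCondExp N ρ)).trace := by
  have hm : invSqrtMat (hsCondExp N ρ) ∈ N :=
    cfc_mem_subalgebra _ (cfc_mem_subalgebra _ (hsCondExp_mem N ρ))
  rw [petz, trace_mul_comm, ← mul_assoc, sqrtMat_mul_self hρ, trace_mul_comm,
    ← trace_mul_hsCondExp (mul_mem (mul_mem hm (hsCondExp_mem N X)) hm),
    mul_assoc, mul_assoc, trace_mul_comm, mul_assoc, mul_assoc,
    ← mul_assoc (invSqrtMat (hsCondExp N ρ)) (hsCondExp N ρ),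
    invSqrtMat_mul_mul_invSqrtMat (posSemidef_hsCondExp hρ)]

end Density

end NormEstimates

/-! ### Stability and equality for the conditional expectation. -/

section Recovery

open Matrix

variable {n : ℕ} {ρ σ : Matrix (Fin n) (Fin n) ℂ}
  {N : StarSubalgebra ℂ (Matrix (Fin n) (Fin n) ℂ)} {f : ℝ → ℝ} {a b : ℝ} {μ : Measure ℝ}

/-- The conditional expectation decreases quasi-entropies. -/
lemma dominates_hsCondExp (hρ : ρ.PosSemidef) (hσ : σ.PosSemidef) (trρ : ρ.trace = 1)
    (hs : σ * supp ρ = σ) :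
    Dominates (relModular σ ρ) (relModular (hsCondExp N σ) (hsCondExp N ρ)) (toHS n (sqrtMat ρ))
      (toHS n (sqrtMat (hsCondExp N ρ))) (petzContraction N 1 ρ (hsCondExp N ρ)) :=
  dominates_of_channel (by
      rw [conjTranspose_one, mul_one, hsCondExp_of_mem (one_mem N), sub_self]
      exact PosSemidef.zero)
    hρ hσ (posSemidef_hsCondExp hρ) (posSemidef_hsCondExp hσ) (by simp) (by simp) trρ
    (by rw [trace_hsCondExp, trρ]) (trace_hsCondExp σ).symm hs (hsCondExp_mul_supp hρ hs)

lemma petzContraction_one_sqrtMat (X : Matrix (Fin n) (Fin n) ℂ) (hX : X ∈ N) :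
    petzContraction N 1 ρ (hsCondExp N ρ) (toHS n (sqrtMat X)) = toHS n (petzRoot N ρ X) := by
  have hm : sqrtMat X * invSqrtMat (hsCondExp N ρ) ∈ N := mul_mem (cfc_mem_subalgebra _ hX)
    (cfc_mem_subalgebra _ (cfc_mem_subalgebra _ (hsCondExp_mem N ρ)))
  rw [petzContraction_toHS, conjTranspose_one, one_mul, mul_one, hsCondExp_of_mem hm, petzRoot]

lemma petzRoot_hsCondExp_self (hρ : ρ.PosSemidef) : petzRoot N ρ (hsCondExp N ρ) = sqrtMat ρ := by
  rw [petzRoot, sqrtMat_mul_invSqrtMat (posSemidef_hsCondExp hρ), supp_hsCondExp_mul_sqrtMat hρ]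

/-- If `R_τ` recovers both states then it cannot increase the quasi-entropy. -/
lemma quasiEntropy_le_of_petz_eq {τ : Matrix (Fin n) (Fin n) ℂ} (hτ : τ.PosSemidef)
    (h : CanonicalRepresentation (fun x => -f x) a b μ)
    (hρ : ρ.PosSemidef) (hσ : σ.PosSemidef) (trρ : ρ.trace = 1) (hs : σ * supp ρ = σ)
    (h₁ : petz N τ (hsCondExp N ρ) = ρ) (h₂ : petz N τ (hsCondExp N σ) = σ) :
    quasiEntropy f ρ σ ≤ quasiEntropy f (hsCondExp N ρ) (hsCondExp N σ) := by
  have hD := dominates_of_channel (N := N) (K := sqrtMat τ * invSqrtMat (hsCondExp N τ))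
    (ρ₁ := hsCondExp N ρ) (σ₁ := hsCondExp N σ) (ρ₂ := ρ) (σ₂ := σ)
    (by rw [hsCondExp_petz_kernel hτ]; exact posSemidef_one_sub_supp (posSemidef_hsCondExp hτ).1)
    (posSemidef_hsCondExp hρ) (posSemidef_hsCondExp hσ) hρ hσ
    (by rw [hsCondExp_of_mem (hsCondExp_mem N ρ), ← petz_eq_mul_mul_conjTranspose, h₁])
    (by rw [hsCondExp_of_mem (hsCondExp_mem N σ), ← petz_eq_mul_mul_conjTranspose, h₂])
    (by rw [trace_hsCondExp, trρ]) trρ (trace_hsCondExp σ) (hsCondExp_mul_supp hρ hs) hs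
  exact hD.specEntropy_le h

lemma supp_eq_one_of_isUnit (hσ : σ.PosSemidef) (hu : IsUnit σ) : supp σ = 1 :=
  hu.mul_left_cancel (by rw [mul_supp hσ, mul_one])

/-- Only the eigenvalue 0 could contribute +∞. If σYρ⁺ = 0 with σ invertible then Yρ⁺ = 0, so Y is
orthogonal to ρ^{1/2} and the spectral mass at 0 vanishes. -/
lemma quasiEntropy_ne_top (hρ : ρ.PosSemidef) (hσ : σ.PosSemidef) (hu : IsUnit σ) :
    quasiEntropy f ρ σ ≠ ⊤ := by
  classical
  rw [quasiEntropy_eq_specEntropy]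
  have hp := isPositive_relModular hσ hρ
  have hsum : ∀ s : Finset ℂ, s ⊆ eigs (relModular σ ρ) →
      ∑ z ∈ s, extendZero f z.re *
        ((specMass (relModular σ ρ) (toHS n (sqrtMat ρ)) z : ℝ) : EReal) ≠ ⊤ := by
    intro s
    induction s using Finset.induction_on with
    | empty => simp
    | insert z s hz ih =>
      intro hsub
      rw [Finset.sum_insert hz]
      refine EReal.add_ne_top ?_ (ih fun w hw => hsub (Finset.mem_insert_of_mem hw))
      have hze := hsub (Finset.mem_insert_self z s)
      rcases (re_nonneg_of_mem_eigs hp hze).eq_or_lt with h0 | h0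
      · have hz0 : z = 0 := by
          rw [← im_eq_zero_of_mem_eigs hp.1 hze, ← h0, Complex.ofReal_zero]
        have hm : specMass (relModular σ ρ) (toHS n (sqrtMat ρ)) z = 0 := by
          obtain ⟨Y, hY⟩ := (toHS n).surjective (specProj (relModular σ ρ) z (toHS n (sqrtMat ρ)))
          have h1 := apply_specProj (relModular σ ρ) z (toHS n (sqrtMat ρ))
          rw [← hY, hz0, zero_smul, relModular_toHS, LinearEquiv.map_eq_zero_iff, mul_assoc] at h1
          have h2 : Y * genInv ρ = 0 := by
            refine hu.mul_left_cancel ?_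
            rw [h1, mul_zero]
          have h3 : inner ℂ (toHS n Y) (toHS n (sqrtMat ρ)) = 0 := by
            have h4 : genInv ρ * Yᴴ = 0 := by
              have := congrArg conjTranspose h2
              rwa [conjTranspose_mul, isHermitian_genInv, conjTranspose_zero] at this
            rw [inner_toHS]
            have h5 : sqrtMat ρ = sqrtMat ρ * ρ * genInv ρ := by
              rw [mul_assoc, mul_genInv hρ, sqrtMat_mul_supp]
            rw [h5, ← mul_assoc, trace_mul_comm, ← mul_assoc, h4, zero_mul, trace_zero]
          have h6 : inner ℂ (specProj (relModular σ ρ) z (toHS n (sqrtMat ρ)))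
              (specProj (relModular σ ρ) z (toHS n (sqrtMat ρ))) = 0 := by
            conv_lhs => lhs; rw [← hY]
            rw [← h3, hY]
            have h7 := Submodule.starProjection_inner_eq_zero
              (K := Module.End.eigenspace (relModular σ ρ) z) (toHS n (sqrtMat ρ)) _
              (specProj_mem (relModular σ ρ) z (toHS n (sqrtMat ρ)))
            rw [inner_sub_left, sub_eq_zero] at h7
            rw [← inner_conj_symm _ (toHS n (sqrtMat ρ)), h7, inner_conj_symm]
            rfl
          rw [specMass, inner_self_eq_zero.mp h6]
          simp
        rw [hm]; simp
      · rw [extendZero, if_pos h0, ← EReal.coe_mul]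
        exact EReal.coe_ne_top _
  exact hsum _ subset_rfl

/-- The constant of the stability estimate for the square roots. -/
def stabilityConst (l C : ℝ) : ℝ := 4 * (1 + √l⁻¹) + (C + 2) / 2

lemma norm_petzRoot_sub_le (hρ : ρ.PosSemidef) (hσ : σ.PosSemidef) (trρ : ρ.trace = 1)
    (trσ : σ.trace = 1) (hs : σ * supp ρ = σ) (h : CanonicalRepresentation (fun x => -f x) a b μ)
    {c C : ℝ} (hc : 0 < c) (hC : 0 < C)
    (hμ : ∀ T : ℝ, 0 < T → leastConst μ T ≤ ENNReal.ofReal (C * T ^ (2 * c)))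
    (hne : quasiEntropy f ρ σ ≠ ⊤) :
    ‖toHS n (petzRoot N ρ (hsCondExp N σ) - sqrtMat σ)‖ ≤
      stabilityConst (minNonzeroEigenvalue ρ) C *
        ((quasiEntropy f ρ σ).toReal -
          (quasiEntropy f (hsCondExp N ρ) (hsCondExp N σ)).toReal) ^ (1 / (4 * (1 + c))) := by
  have hD := dominates_hsCondExp (N := N) hρ hσ trρ hs
  have hρ0 : ρ ≠ 0 := fun h0 => by simp [h0] at trρ
  have hρN := posSemidef_hsCondExp (N := N) hρ
  have hσN := posSemidef_hsCondExp (N := N) hσ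
  have trρN : (hsCondExp N ρ).trace = 1 := by rw [trace_hsCondExp, trρ]
  have trσN : (hsCondExp N σ).trace = 1 := by rw [trace_hsCondExp, trσ]
  have hsN := hsCondExp_mul_supp (N := N) hρ hs
  have hκ : 0 < (minNonzeroEigenvalue ρ)⁻¹ := inv_pos.mpr (minNonzeroEigenvalue_pos hρ hρ0).1
  have hle : ((((minNonzeroEigenvalue ρ)⁻¹ : ℝ) : ℂ) • ρ - σ).PosSemidef :=
    posSemidef_inv_minNonzeroEigenvalue_smul_sub hρ hρ0 hσ trσ hs
  -- The order bound passes to N, so the same L = λ^{-1/2} serves both modular operators.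
  have hleN := posSemidef_hsCondExp (N := N) hle
  rw [hsCondExp_sub, hsCondExp_smul] at hleN
  have e₁ := specMap_sqrt_relModular hσ hρ hs
  have e₂ := specMap_sqrt_relModular hσN hρN hsN
  have := hD.stability h hne
    (by rw [petzContraction_one_sqrtMat _ (hsCondExp_mem N ρ), petzRoot_hsCondExp_self hρ])
    hc hC hμ (norm_sqrtMat hρ trρ) (norm_relModular_le hρ hσ trσ hκ hle)
    (norm_relModular_le hρN hσN trσN hκ hleN)
    (by rw [e₁, norm_sqrtMat hσ trσ]) (by rw [e₂, norm_sqrtMat hσN trσN])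
  rwa [e₁, e₂, petzContraction_one_sqrtMat _ (hsCondExp_mem N σ), ← map_sub] at this

lemma norm_petzRoot_le (hρ : ρ.PosSemidef) (hσ : σ.PosSemidef) (trρ : ρ.trace = 1)
    (trσ : σ.trace = 1) (hs : σ * supp ρ = σ) :
    ‖toHS n (petzRoot N ρ (hsCondExp N σ))‖ ≤ 1 := by
  have h := (dominates_hsCondExp (N := N) hρ hσ trρ hs).norm_le
    (toHS n (sqrtMat (hsCondExp N σ)))
  rwa [petzContraction_one_sqrtMat _ (hsCondExp_mem N σ),
    norm_sqrtMat (posSemidef_hsCondExp hσ) (by rw [trace_hsCondExp, trσ])] at h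

lemma traceNorm_petz_sub_le (hσ : σ.PosSemidef)
    (trσ : σ.trace = 1) (hn : ‖toHS n (petzRoot N ρ (hsCondExp N σ))‖ ≤ 1) :
    traceNorm (petz N ρ (hsCondExp N σ) - σ) ≤
      2 * ‖toHS n (petzRoot N ρ (hsCondExp N σ) - sqrtMat σ)‖ := by
  have h := traceNorm_sub_le (petzRoot N ρ (hsCondExp N σ)) (sqrtMat σ)
  rw [petzRoot_conjTranspose_mul_self (posSemidef_hsCondExp hσ), isHermitian_sqrtMat,
    sqrtMat_mul_self hσ, norm_sqrtMat hσ trσ] at h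
  refine h.trans (mul_le_mul_of_nonneg_right (by linarith) (norm_nonneg _))

/-- Since σ_N^{-1/2}σ_N^{1/2} = 1, the left factor ρ_N^{1/2}σ_N^{-1/2} turns the first root into
ρ^{1/2} and σ^{1/2} into the root for R_σ, which exchanges the two states. -/
lemma mul_petzRoot_sub (hu : IsUnit (hsCondExp N σ)) (hρ : ρ.PosSemidef)
    (hσ : σ.PosSemidef) :
    sqrtMat (hsCondExp N ρ) * (invSqrtMat (hsCondExp N σ) *
      (petzRoot N ρ (hsCondExp N σ) - sqrtMat σ)) =
      sqrtMat ρ - petzRoot N σ (hsCondExp N ρ) := by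
  have h1 := supp_eq_one_of_isUnit (posSemidef_hsCondExp (N := N) hσ) hu
  have h2 : sqrtMat (hsCondExp N ρ) * (invSqrtMat (hsCondExp N σ) *
      petzRoot N ρ (hsCondExp N σ)) = petzRoot N ρ (hsCondExp N ρ) := by
    rw [petzRoot, mul_assoc, ← mul_assoc (invSqrtMat (hsCondExp N σ)),
      invSqrtMat_mul_sqrtMat (posSemidef_hsCondExp hσ), h1, one_mul, petzRoot, mul_assoc]
  rw [mul_sub, mul_sub, h2, petzRoot_hsCondExp_self hρ, petzRoot, mul_assoc]

lemma norm_petzRoot_swap_sub_le (hu : IsUnit (hsCondExp N σ)) (hρ : ρ.PosSemidef)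
    (hσ : σ.PosSemidef) (trρ : ρ.trace = 1) :
    ‖toHS n (petzRoot N σ (hsCondExp N ρ) - sqrtMat ρ)‖ ≤ √(opNorm (hsCondExp N σ)⁻¹) *
      ‖toHS n (petzRoot N ρ (hsCondExp N σ) - sqrtMat σ)‖ := by
  have hρN := posSemidef_hsCondExp (N := N) hρ
  rw [map_sub, norm_sub_rev, ← map_sub, ← mul_petzRoot_sub hu hρ hσ]
  refine (norm_toHS_mul_le ?_ _).trans
    (norm_toHS_invSqrtMat_mul_le (posSemidef_hsCondExp hσ) hu _)
  rw [isHermitian_sqrtMat, sqrtMat_mul_self hρN]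
  exact posSemidef_one_sub_of_trace_eq_one hρN (by rw [trace_hsCondExp, trρ])

/-- The contraction argument of `norm_petzRoot_le` would need ker σ ⊆ ker ρ. Instead the squared
norm is Tr R_σ(ρ_N), which equals Tr ρ_N because σ_N has full support. -/
lemma norm_petzRoot_swap_le (hu : IsUnit (hsCondExp N σ)) (hρ : ρ.PosSemidef)
    (hσ : σ.PosSemidef) (trρ : ρ.trace = 1) :
    ‖toHS n (petzRoot N σ (hsCondExp N ρ))‖ ≤ 1 := by
  refine le_of_sq_le_sq ?_ zero_le_one
  rw [norm_sq_toHS, petzRoot_conjTranspose_mul_self (posSemidef_hsCondExp hρ),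
    trace_petz_hsCondExp hσ, supp_eq_one_of_isUnit (posSemidef_hsCondExp hσ) hu, mul_one,
    trace_hsCondExp, trρ]
  simp

end Recovery

end QuasiEntropy

end

/-! ### Assembly of the theorem. -/

open QuasiEntropy in
theorem corollary4p5 :
    ∃ (K : ℝ → ℝ → ℝ → ℝ → ℝ) (K' : ℝ → ℝ → ℝ → ℝ),
      ∀ (n : ℕ) (M N : StarSubalgebra ℂ (Matrix (Fin n) (Fin n) ℂ)), N ≤ M →
      ∀ (f : ℝ → ℝ), OperatorMonotoneDecreasing f →
      ∀ (a b : ℝ) (μ : MeasureTheory.Measure ℝ),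
        CanonicalRepresentation (fun x => -f x) a b μ → RegularMeasure μ →
      ∀ (c C : ℝ), 0 < c → 0 < C →
        (∀ T : ℝ, 0 < T → leastConst μ T ≤ ENNReal.ofReal (C * T ^ (2 * c))) →
      ∀ (ρ σ : Matrix (Fin n) (Fin n) ℂ), IsDensityMatrix M ρ → IsDensityMatrix M σ →
        (∀ v : Fin n → ℂ, Matrix.mulVec ρ v = 0 → Matrix.mulVec σ v = 0) →
      -- the data processing inequality, so that the differences below are non-negative
      quasiEntropy f (hsCondExp N ρ) (hsCondExp N σ) ≤ quasiEntropy f ρ σ ∧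
      -- the bound without invertibility
      (quasiEntropy f ρ σ ≠ ⊤ →
        traceNorm (petz N ρ (hsCondExp N σ) - σ) ≤
          K' (minNonzeroEigenvalue ρ) C c *
            ((quasiEntropy f ρ σ).toReal -
              (quasiEntropy f (hsCondExp N ρ) (hsCondExp N σ)).toReal) ^ (1 / (4 * (1 + c)))) ∧
      (IsUnit (hsCondExp N σ) →
        -- the bound when `σ_N` is invertible
        (quasiEntropy f ρ σ ≠ ⊤ →
          max (traceNorm (petz N ρ (hsCondExp N σ) - σ)) (traceNorm (petz N σ (hsCondExp N ρ) - ρ)) ≤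
            K (minNonzeroEigenvalue ρ) (opNorm (hsCondExp N σ)⁻¹) C c *
              ((quasiEntropy f ρ σ).toReal -
                (quasiEntropy f (hsCondExp N ρ) (hsCondExp N σ)).toReal) ^ (1 / (4 * (1 + c)))) ∧
        -- equality in the data processing inequality and perfect recovery
        (quasiEntropy f ρ σ = quasiEntropy f (hsCondExp N ρ) (hsCondExp N σ) ↔
          petz N ρ (hsCondExp N σ) = σ ∧ petz N σ (hsCondExp N ρ) = ρ) ∧
        (petz N ρ (hsCondExp N σ) = σ ∨ petz N σ (hsCondExp N ρ) = ρ →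
          quasiEntropy f ρ σ = quasiEntropy f (hsCondExp N ρ) (hsCondExp N σ))) := by
  -- The factor 2 comes from `traceNorm_petz_sub_le`, and 1 + √m dominates both 1 and the loss √m of
  -- the exchange.
  refine ⟨fun l m C _ => 2 * ((1 + √m) * stabilityConst l C),
    fun l C _ => 2 * stabilityConst l C, ?_⟩
  intro n M N _ f _ a b μ h _ c C hc hC hμ ρ σ hρM hσM hker
  have hρ := hρM.posSemidef
  have hσ := hσM.posSemidef
  have trρ := hρM.trace_eq_one
  have trσ := hσM.trace_eq_one
  have hs := mul_supp_of_ker_le hρ hker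
  have hdpi : quasiEntropy f (hsCondExp N ρ) (hsCondExp N σ) ≤ quasiEntropy f ρ σ :=
    (dominates_hsCondExp hρ hσ trρ hs).specEntropy_le h
  have hmain := norm_petzRoot_sub_le (N := N) hρ hσ trρ trσ hs h hc hC hμ
  have hnA := norm_petzRoot_le (N := N) hρ hσ trρ trσ hs
  refine ⟨hdpi, fun hne => ?_, fun hu => ?_⟩
  · rw [mul_assoc]
    exact (traceNorm_petz_sub_le hσ trσ hnA).trans
      (mul_le_mul_of_nonneg_left (hmain hne) zero_le_two)
  have hswap := norm_petzRoot_swap_sub_le hu hρ hσ trρ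
  have hback : petz N ρ (hsCondExp N σ) = σ ∨ petz N σ (hsCondExp N ρ) = ρ →
      quasiEntropy f ρ σ = quasiEntropy f (hsCondExp N ρ) (hsCondExp N σ) := by
    -- Each recovery map always restores its own reference state, so a single equation makes it
    -- restore both.
    rintro (hr | hr)
    · exact le_antisymm
        (quasiEntropy_le_of_petz_eq hρ h hρ hσ trρ hs (petz_hsCondExp_self hρ) hr) hdpi
    · exact le_antisymm
        (quasiEntropy_le_of_petz_eq hσ h hρ hσ trρ hs hr (petz_hsCondExp_self hσ)) hdpi
  refine ⟨fun hne => ?_, ⟨fun heq => ?_, fun hr => hback (Or.inl hr.1)⟩, hback⟩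
  · have h1 := traceNorm_petz_sub_le hσ trσ hnA
    have h2 := traceNorm_petz_sub_le hρ trρ (norm_petzRoot_swap_le hu hρ hσ trρ)
    have h3 := hmain hne
    set D := ‖toHS n (petzRoot N ρ (hsCondExp N σ) - sqrtMat σ)‖
    have hD : 0 ≤ D := norm_nonneg _
    have hm : 0 ≤ √(opNorm (hsCondExp N σ)⁻¹) := Real.sqrt_nonneg _
    have h4 := mul_le_mul_of_nonneg_left h3 (by positivity :
      0 ≤ 2 * (1 + √(opNorm (hsCondExp N σ)⁻¹)))
    have h5 : 0 ≤ √(opNorm (hsCondExp N σ)⁻¹) * D := mul_nonneg hm hD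
    refine max_le ?_ ?_ <;> linarith
  -- The matrix σ may be singular, so finiteness is taken from the invertible σ_N through the
  -- assumed equality.
  · have hne : quasiEntropy f ρ σ ≠ ⊤ := by
      rw [heq]
      exact quasiEntropy_ne_top (posSemidef_hsCondExp hρ) (posSemidef_hsCondExp hσ) hu
    have h1 := hmain hne
    rw [← heq, sub_self, Real.zero_rpow (by positivity), mul_zero] at h1
    rw [le_antisymm h1 (norm_nonneg _), mul_zero] at hswap
    have e1 : petzRoot N ρ (hsCondExp N σ) = sqrtMat σ := by
      simpa [sub_eq_zero] using le_antisymm h1 (norm_nonneg _)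
    have e2 : petzRoot N σ (hsCondExp N ρ) = sqrtMat ρ := by
      simpa [sub_eq_zero] using le_antisymm hswap (norm_nonneg _)
    constructor
    · rw [← petzRoot_conjTranspose_mul_self (posSemidef_hsCondExp hσ), e1, isHermitian_sqrtMat,
        sqrtMat_mul_self hσ]
    · rw [← petzRoot_conjTranspose_mul_self (posSemidef_hsCondExp hρ), e2, isHermitian_sqrtMat,
        sqrtMat_mul_self hρ]
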